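/- Consider a discrete-time load balancing system with one dispatcher and $N$ parallel servers. Let $Q_n(t)\in\mathbb{Z}_{\ge 0}$ be the length of queue $n$ at the beginning of slot $t$, and let $m(t)\subseteq\{1,\dots,N\}$ be the set of server IDs that the dispatcher has in its memory. In slot $t$ there are $A_\Sigma(t)\in\mathbb{Z}_{\ge 0}$ exogenous arrivals, i.i.d. over time. They are all routed to one server $s(t)$, drawn from a probability distribution that is prescribed by the policy as a function of $(\mathbf{Q}(t),m(t))$; thus $A_n(t)=A_\Sigma(t)$ for $n=s(t)$ and $A_n(t)=0$ otherwise. Queue $n$ is offered the service $S_n(t)\in\mathbb{Z}_{\ge 0}$, i.i.d. over time, independent across the servers and independent of the arrivals. Given $(\mathbf{Q}(t),m(t))$, the variables $A_\Sigma(t)$, $s(t)$ and $S_1(t),\dots,S_N(t)$ are independent. The queues evolve by $Q_n(t+1)=\max(Q_n(t)+A_n(t)-S_n(t),0)$. The memory $m(t+1)$ is drawn by the policy from a distribution that may depend on $(\mathbf{Q}(t),m(t))$, $A_\Sigma(t)$, $s(t)$ and $\mathbf{S}(t)$. Hence $Z(t)=(\mathbf{Q}(t),m(t))$ is a time-homogeneous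 Markov chain. Fix the policy and the service laws, with $S_n(t)\le S_{\max}<\infty$, and let $\mu_\Sigma=\sum_n\mathbb{E}[S_n(t)]>0$. For each $\epsilon\in(0,\mu_\Sigma)$ let $Z^{(\epsilon)}$ be the system whose arrivals $A_\Sigma^{(\epsilon)}(t)$ have mean $\lambda_\Sigma=\mu_\Sigma-\epsilon$, where $A_\Sigma^{(\epsilon)}(t)\le A_{\max}$ for a finite constant $A_{\max}$ that does not depend on $\epsilon$, and where $\operatorname{Var}(A_\Sigma^{(\epsilon)}(t))$ converges to a finite constant as $\epsilon\downarrow 0$. Let the state space $\mathcal{Z}$ be a nonempty set of states that, for every $\epsilon\in(0,\mu_\Sigma)$, the chain $Z^{(\epsilon)}$ does not leave. The resource-pooled single-server queue is the Markov chain on $\mathbb{Z}_{\ge 0}$ given by $q^{(\epsilon)}(t+1)=\max\bigl(q^{(\epsilon)}(t)+A_\Sigma^{(\epsilon)}(t)-\sum_n S_n(t),0\bigr)$. Let $\|\cdot\|$ be the Euclidean norm, let $\mathbf{c}=\frac{1}{\sqrt N}(1,\dots,1)$, and let $\mathbf{Q}_\perp=\mathbf{Q}-\langle\mathbf{Q},\mathbf{c}\rangle\mathbf{c}$.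 Assume: (a) for every $\epsilon\in(0,\mu_\Sigma)$ there are an integer $T_1>0$ and reals $K_1\ge 0$ and $\gamma>0$ such that for all $t_0$ and all $Z=(\mathbf{Q},m)\in\mathcal{Z}$ $$\mathbb{E}\Bigl[\sum_{t=t_0}^{t_0+T_1-1}\langle\mathbf{Q}(t),\mathbf{A}(t)-\mathbf{S}(t)\rangle\,\Big|\,Z(t_0)=Z\Bigr]\le-\gamma\|\mathbf{Q}\|+K_1;$$ (b) there are an integer $T_2>0$ and reals $K_2\ge 0$, $\eta>0$ and $\epsilon_0>0$, none of them depending on $\epsilon$, such that for all $\epsilon\in(0,\epsilon_0)$ with $\epsilon<\mu_\Sigma$, all $t_0$ and all $Z=(\mathbf{Q},m)\in\mathcal{Z}$ $$\mathbb{E}\Bigl[\sum_{t=t_0}^{t_0+T_2-1}\langle\mathbf{Q}_\perp(t),\mathbf{A}(t)-\mathbf{S}(t)\rangle\,\Big|\,Z(t_0)=Z\Bigr]\le-\eta\|\mathbf{Q}_\perp\|+K_2.$$ Then, for every $\epsilon\in(0,\mu_\Sigma)$, the chain $Z^{(\epsilon)}$ has a stationary distribution on $\mathcal{Z}$, and so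 does the resource-pooled queue on $\mathbb{Z}_{\ge 0}$; under every stationary distribution the mean total queue length of the system, respectively the mean queue length of the resource-pooled queue, is finite. Moreover the system is heavy-traffic delay optimal: if $\overline{\mathbf{Q}}^{(\epsilon)}$ and $\overline{q}^{(\epsilon)}$ denote the queue lengths under any stationary distributions of $Z^{(\epsilon)}$ on $\mathcal{Z}$ and of $q^{(\epsilon)}$, then the following two limits exist, are equal, and do not depend on the choice of the stationary distributions: $$\lim_{\epsilon\downarrow 0}\epsilon\,\mathbb{E}\Bigl[\sum_n\overline{Q}_n^{(\epsilon)}\Bigr]=\lim_{\epsilon\downarrow 0}\epsilon\,\mathbb{E}\bigl[\overline{q}^{(\epsilon)}\bigr].$$ -/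

import Mathlib

namespace LoadBalancing

noncomputable section

/-- Expectation of a real function under a discrete probability distribution. -/
def expect {α : Type*} (p : PMF α) (f : α → ℝ) : ℝ :=
  letI : MeasurableSpace α := ⊤
  ∫ x, f x ∂p.toMeasure

/-- The function has a finite expectation (it is absolutely integrable). -/
def HasFiniteMean {α : Type*} (p : PMF α) (f : α → ℝ) : Prop :=
  letI : MeasurableSpace α := ⊤
  MeasureTheory.Integrable f p.toMeasure

/-- Variance of a law on `ℕ`. -/
def natVariance (p : PMF ℕ) : ℝ :=
  ProbabilityTheory.variance (fun a : ℕ => (a : ℝ)) p.toMeasure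

/-- A state `Z = (Q, m)`: the queue lengths of the `N` servers, and the set of server IDs that are
stored in the memory of the dispatcher. -/
@[ext]
structure State (N : ℕ) where
  queue : Fin N → ℕ
  memory : Finset (Fin N)

/-- What happens in one time slot: the number of exogenous arrivals, the server to which all of
them are routed, the offered services, and the content of the memory after the slot. -/
@[ext]
structure Slot (N : ℕ) where
  arrivals : ℕ
  dest : Fin N
  service : Fin N → ℕ
  newMemory : Finset (Fin N)

/-- A load balancing policy. The destination of the arrivals is drawn from a distribution that
depends on the state `Z = (Q, m)`; the new content of the memory is drawn from a distribution that
may depend on everything that happens in the slot (the state, the arrivals, the destination, the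
offered services, and hence the new queue lengths). -/
structure Policy (N : ℕ) where
  dispatch : State N → PMF (Fin N)
  updateMemory : State N → ℕ → Fin N → (Fin N → ℕ) → PMF (Finset (Fin N))

/-- A load balancing system: the law of the number of exogenous arrivals in a slot, the laws of the
services offered by the servers in a slot, and the policy. -/
structure System (N : ℕ) where
  arrival : PMF ℕ
  service : Fin N → PMF ℕ
  policy : Policy N

/-- The joint law of the services offered in one slot; the servers are independent. -/
def serviceLaw {N : ℕ} (service : Fin N → PMF ℕ) : PMF (Fin N → ℕ) :=
  (MeasureTheory.Measure.pi fun n => (service n).toMeasure).toPMF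

/-- `A_n(t)`: all the arrivals of the slot go to the chosen server. -/
def Slot.routed {N : ℕ} (ω : Slot N) (n : Fin N) : ℕ :=
  if n = ω.dest then ω.arrivals else 0

/-- The state after the slot, `Q_n(t+1) = [Q_n(t) + A_n(t) - S_n(t)]⁺` (the subtraction of natural
numbers is truncated at `0`). -/
def State.next {N : ℕ} (Z : State N) (ω : Slot N) : State N where
  queue n := Z.queue n + ω.routed n - ω.service n
  memory := ω.newMemory

/-- The law of the events of a slot that starts in state `Z`. The arrivals, the services and the
destination are independent of each other, given `Z`. -/
def System.slotLaw {N : ℕ} (sys : System N) (Z : State N) : PMF (Slot N) :=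
  sys.arrival.bind fun a =>
    (serviceLaw sys.service).bind fun S =>
      (sys.policy.dispatch Z).bind fun s =>
        (sys.policy.updateMemory Z a s S).map fun m => ⟨a, s, S, m⟩

/-- The transition law of the Markov chain `Z(t) = (Q(t), m(t))`. -/
def System.step {N : ℕ} (sys : System N) (Z : State N) : PMF (State N) :=
  (sys.slotLaw Z).map Z.next

/-- The conditional law, given `Z(t₀) = Z`, of the states `Z(t)` and the events of the slots
`t = t₀, …, t₀ + T - 1`. It does not depend on `t₀` since the chain is time-homogeneous. -/
def System.pathLaw {N : ℕ} (sys : System N) : ℕ → State N → PMF (List (State N × Slot N))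
  | 0, _ => PMF.pure []
  | T + 1, Z => (sys.slotLaw Z).bind fun ω => (sys.pathLaw T (Z.next ω)).map fun l => (Z, ω) :: l

/-- The conditional expectation, given `Z(t₀) = Z`, of the sum of `f (Z(t), events of slot t)` over
`t = t₀, …, t₀ + T - 1`. -/
def System.condSum {N : ℕ} (sys : System N) (T : ℕ) (f : State N → Slot N → ℝ) (Z : State N) : ℝ :=
  expect (sys.pathLaw T Z) fun l => (l.map fun x => f x.1 x.2).sum

/-- The vector `Q` of queue lengths, in `ℝᴺ` with the Euclidean norm. -/
def State.vec {N : ℕ} (Z : State N) : EuclideanSpace ℝ (Fin N) :=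
  WithLp.toLp 2 fun n => (Z.queue n : ℝ)

/-- The vector `A(t) - S(t)`. -/
def Slot.netVec {N : ℕ} (ω : Slot N) : EuclideanSpace ℝ (Fin N) :=
  WithLp.toLp 2 fun n => (ω.routed n : ℝ) - (ω.service n : ℝ)

/-- The unit vector `c = (1, …, 1) / √N`. -/
def unitDiag (N : ℕ) : EuclideanSpace ℝ (Fin N) :=
  WithLp.toLp 2 fun _ => 1 / Real.sqrt (N : ℝ)

/-- The perpendicular component `Q_⊥ = Q - ⟨Q, c⟩ c`. -/
def State.perp {N : ℕ} (Z : State N) : EuclideanSpace ℝ (Fin N) :=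
  Z.vec - (inner ℝ Z.vec (unitDiag N)) • unitDiag N

/-- `𝒵` can serve as the state space of the chain: it is nonempty, and the chain does not
leave it. -/
def System.IsStateSpace {N : ℕ} (sys : System N) (𝒵 : Set (State N)) : Prop :=
  𝒵.Nonempty ∧ ∀ Z ∈ 𝒵, ∀ Z' ∈ (sys.step Z).support, Z' ∈ 𝒵

/-- `ν` is a stationary distribution of the chain on the state space `𝒵`. -/
def System.IsStationary {N : ℕ} (sys : System N) (𝒵 : Set (State N)) (ν : PMF (State N)) : Prop :=
  ν.support ⊆ 𝒵 ∧ ν.bind sys.step = ν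

/-- The transition law of the resource-pooled single-server queue,
`q(t+1) = [q(t) + A_Σ(t) - ∑ₙ S_n(t)]⁺`. -/
def pooledStep {N : ℕ} (arrival : PMF ℕ) (service : Fin N → PMF ℕ) (q : ℕ) : PMF ℕ :=
  arrival.bind fun a => (serviceLaw service).map fun S => q + a - ∑ n, S n

/-- `ρ` is a stationary distribution of the resource-pooled single-server queue. -/
def IsPooledStationary {N : ℕ} (arrival : PMF ℕ) (service : Fin N → PMF ℕ) (ρ : PMF ℕ) : Prop :=
  ρ.bind (pooledStep arrival service) = ρ

/-- The condition on the drift of the queue lengths: there are `T₁ > 0`, `K₁ ≥ 0` and `γ > 0` with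
`E[∑_{t = t₀}^{t₀ + T₁ - 1} ⟨Q(t), A(t) - S(t)⟩ | Z(t₀) = Z] ≤ -γ ‖Q‖ + K₁` for all `Z ∈ 𝒵`. -/
def System.ThroughputCondition {N : ℕ} (sys : System N) (𝒵 : Set (State N)) : Prop :=
  ∃ (T₁ : ℕ) (K₁ γ : ℝ), 0 < T₁ ∧ 0 ≤ K₁ ∧ 0 < γ ∧ ∀ Z ∈ 𝒵,
    sys.condSum T₁ (fun Z' ω => inner ℝ Z'.vec ω.netVec) Z ≤ -γ * ‖Z.vec‖ + K₁

/-- The condition on the drift of the perpendicular component, with given constants: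
`E[∑_{t = t₀}^{t₀ + T₂ - 1} ⟨Q_⊥(t), A(t) - S(t)⟩ | Z(t₀) = Z] ≤ -η ‖Q_⊥‖ + K₂` for all
`Z ∈ 𝒵`. -/
def System.PerpCondition {N : ℕ} (sys : System N) (𝒵 : Set (State N)) (T₂ : ℕ) (K₂ η : ℝ) : Prop :=
  ∀ Z ∈ 𝒵, sys.condSum T₂ (fun Z' ω => inner ℝ Z'.perp ω.netVec) Z ≤ -η * ‖Z.perp‖ + K₂

end

end LoadBalancing

namespace LoadBalancing

noncomputable section

open MeasureTheory
open scoped ENNReal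

/-! In equilibrium the drift of the squared total queue length vanishes. Let `x` be the total, `d`
the net input, `u` the unused service and `x' = x + d + u` the next total. Then `x' ^ 2 + u ^ 2 = x
^ 2 + 2 x d + d ^ 2 + 2 x' u`. The net input has mean `-ε` in every state, so taking means gives `2
ε E[x] = E[d ^ 2] + 2 E[x' u] - E[u ^ 2]`. The zero drift of `x` itself gives `E[u] = ε`, so `E[u ^
2]` is of order `ε`. The pooled queue satisfies the same identity with the same `E[d ^ 2]`, and
there `x' u = 0`. Hence everything rests on `E[x' u] → 0` for the system (`heavy_traffic_bounds`).

A server with unused service ends the slot empty, so the total is then at most `N` times the length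
of the perpendicular component (`total_next_mul_unused_le`). Young's inequality with weight `√ε`
bounds `E[x' u]` by order `√ε`, provided that the second moment of the perpendicular component is
bounded uniformly in `ε`. This state-space collapse is `System.perp_second_moment`.

The moment bounds come from cubic Lyapunov functions. If `V` has bounded increments and `V ^ 2` has
multi-step drift at most `-2 η V + K`, then `V ^ 3` has drift at most `-η V ^ 2` plus a constant
(`cubic_drift`), and the mean of `V ^ 2` is bounded under every stationary distribution
(`lexpect_le_of_drift`). With `V = ‖Q‖` this gives existence and finite moments for each `ε`; with
`V = ‖Q_⊥‖` and the uniform second drift condition it gives the collapse. Existence uses limits of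
Cesàro averages (`exists_stationary`), so no irreducibility is needed. -/

/-- Expectation of an extended nonnegative function under a discrete distribution. -/
def lexpect {α : Type*} (p : PMF α) (f : α → ℝ≥0∞) : ℝ≥0∞ :=
  letI : MeasurableSpace α := ⊤
  ∫⁻ x, f x ∂p.toMeasure

/-! ### Expectations under discrete laws, extended nonnegative and real. -/

section Expectation

variable {α β : Type*}

lemma lexpect_eq_tsum [Countable α] (p : PMF α) (f : α → ℝ≥0∞) :
    lexpect p f = ∑' a, p a * f a := by
  let : MeasurableSpace α := ⊤
  unfold lexpect
  rw [lintegral_countable']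
  refine tsum_congr fun a => ?_
  rw [PMF.toMeasure_apply_singleton _ _ (MeasurableSet.singleton a), mul_comm]

lemma lexpect_mono {p : PMF α} {f g : α → ℝ≥0∞} (h : ∀ a, f a ≤ g a) :
    lexpect p f ≤ lexpect p g :=
  letI : MeasurableSpace α := ⊤
  lintegral_mono h

lemma lexpect_add (p : PMF α) (f g : α → ℝ≥0∞) :
    lexpect p (fun a => f a + g a) = lexpect p f + lexpect p g :=
  letI : MeasurableSpace α := ⊤
  lintegral_add_left measurable_from_top _

lemma lexpect_sum {ι : Type*} (p : PMF α) (s : Finset ι) (f : ι → α → ℝ≥0∞) :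
    lexpect p (fun a => ∑ i ∈ s, f i a) = ∑ i ∈ s, lexpect p (f i) :=
  letI : MeasurableSpace α := ⊤
  lintegral_finsetSum _ fun _ _ => measurable_from_top

lemma lexpect_const (p : PMF α) (c : ℝ≥0∞) : lexpect p (fun _ => c) = c := by
  let : MeasurableSpace α := ⊤
  simp [lexpect]

lemma lexpect_const_mul (p : PMF α) (c : ℝ≥0∞) (f : α → ℝ≥0∞) :
    lexpect p (fun a => c * f a) = c * lexpect p f :=
  letI : MeasurableSpace α := ⊤
  lintegral_const_mul _ measurable_from_top

lemma ae_of_support (p : PMF α) {q : α → Prop} (h : ∀ a ∈ p.support, q a) :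
    letI : MeasurableSpace α := ⊤
    ∀ᵐ a ∂p.toMeasure, q a := by
  let : MeasurableSpace α := ⊤
  rw [ae_iff, PMF.toMeasure_apply_eq_zero_iff _ MeasurableSpace.measurableSet_top]
  exact Set.disjoint_left.2 fun a ha hn => hn (h a ha)

lemma lexpect_congr_support {p : PMF α} {f g : α → ℝ≥0∞} (h : ∀ a ∈ p.support, f a = g a) :
    lexpect p f = lexpect p g :=
  letI : MeasurableSpace α := ⊤
  lintegral_congr_ae (ae_of_support p h)

lemma lexpect_pure (a : α) (f : α → ℝ≥0∞) : lexpect (PMF.pure a) f = f a := by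
  let : MeasurableSpace α := ⊤
  unfold lexpect
  rw [PMF.toMeasure_pure, lintegral_dirac]

lemma toMeasure_bind [Countable α] (p : PMF α) (q : α → PMF β) :
    letI : MeasurableSpace α := ⊤
    letI : MeasurableSpace β := ⊤
    (p.bind q).toMeasure = p.toMeasure.bind fun a => (q a).toMeasure := by
  let : MeasurableSpace α := ⊤
  let : MeasurableSpace β := ⊤
  ext s hs
  rw [PMF.toMeasure_bind_apply _ _ _ hs,
    Measure.bind_apply hs (measurable_from_top).aemeasurable, lintegral_countable']
  refine tsum_congr fun a => ?_
  rw [PMF.toMeasure_apply_singleton _ _ (MeasurableSet.singleton a), mul_comm]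

lemma lexpect_bind [Countable α] (p : PMF α) (q : α → PMF β) (f : β → ℝ≥0∞) :
    lexpect (p.bind q) f = lexpect p fun a => lexpect (q a) f := by
  let : MeasurableSpace α := ⊤
  let : MeasurableSpace β := ⊤
  unfold lexpect
  rw [toMeasure_bind, Measure.lintegral_bind measurable_from_top.aemeasurable
    measurable_from_top.aemeasurable]

lemma hasFiniteMean_of_bounded {p : PMF α} {f : α → ℝ} (C : ℝ)
    (h : ∀ a ∈ p.support, |f a| ≤ C) : HasFiniteMean p f := by
  let : MeasurableSpace α := ⊤
  exact Integrable.of_bound (measurable_from_top.aestronglyMeasurable) C (ae_of_support p h)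

lemma HasFiniteMean.mono {p : PMF α} {f g : α → ℝ} (hg : HasFiniteMean p g)
    (h : ∀ a ∈ p.support, |f a| ≤ g a) : HasFiniteMean p f := by
  let : MeasurableSpace α := ⊤
  exact Integrable.mono' hg measurable_from_top.aestronglyMeasurable (ae_of_support p h)

lemma hasFiniteMean_of_finite {p : PMF α} (hp : p.support.Finite) (f : α → ℝ) :
    HasFiniteMean p f := by
  obtain ⟨C, hC⟩ := (hp.image fun a => |f a|).bddAbove
  exact hasFiniteMean_of_bounded C fun a ha => hC ⟨a, ha, rfl⟩

lemma HasFiniteMean.add {p : PMF α} {f g : α → ℝ} (hf : HasFiniteMean p f)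
    (hg : HasFiniteMean p g) : HasFiniteMean p fun a => f a + g a :=
  letI : MeasurableSpace α := ⊤
  Integrable.add hf hg

lemma HasFiniteMean.const_mul {p : PMF α} {f : α → ℝ} (hf : HasFiniteMean p f) (c : ℝ) :
    HasFiniteMean p fun a => c * f a :=
  letI : MeasurableSpace α := ⊤
  Integrable.const_mul hf c

lemma hasFiniteMean_const (p : PMF α) (c : ℝ) : HasFiniteMean p fun _ => c :=
  hasFiniteMean_of_bounded |c| fun _ _ => le_rfl

lemma hasFiniteMean_of_sq {p : PMF α} {x : α → ℝ}
    (h : HasFiniteMean p fun z => x z ^ 2) : HasFiniteMean p x :=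
  (h.add (hasFiniteMean_const p 1)).mono fun z _ => by
    rw [abs_le]
    constructor <;> nlinarith [sq_nonneg (x z - 1), sq_nonneg (x z + 1)]

lemma expect_add {p : PMF α} {f g : α → ℝ} (hf : HasFiniteMean p f) (hg : HasFiniteMean p g) :
    expect p (fun a => f a + g a) = expect p f + expect p g :=
  letI : MeasurableSpace α := ⊤
  integral_add hf hg

lemma expect_const_mul (p : PMF α) (c : ℝ) (f : α → ℝ) :
    expect p (fun a => c * f a) = c * expect p f :=
  letI : MeasurableSpace α := ⊤
  integral_const_mul c f

lemma expect_const (p : PMF α) (c : ℝ) : expect p (fun _ => c) = c := by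
  let : MeasurableSpace α := ⊤
  simp [expect]

lemma expect_mono {p : PMF α} {f g : α → ℝ} (hf : HasFiniteMean p f) (hg : HasFiniteMean p g)
    (h : ∀ a ∈ p.support, f a ≤ g a) : expect p f ≤ expect p g :=
  letI : MeasurableSpace α := ⊤
  integral_mono_ae hf hg (ae_of_support p h)

lemma expect_congr {p : PMF α} {f g : α → ℝ} (h : ∀ a ∈ p.support, f a = g a) :
    expect p f = expect p g :=
  letI : MeasurableSpace α := ⊤
  integral_congr_ae (ae_of_support p h)

lemma HasFiniteMean.congr {p : PMF α} {f g : α → ℝ} (hf : HasFiniteMean p f)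
    (h : ∀ a ∈ p.support, f a = g a) : HasFiniteMean p g :=
  letI : MeasurableSpace α := ⊤
  Integrable.congr hf (ae_of_support p h)

lemma expect_nonneg {p : PMF α} {f : α → ℝ} (h : ∀ a ∈ p.support, 0 ≤ f a) : 0 ≤ expect p f :=
  letI : MeasurableSpace α := ⊤
  integral_nonneg_of_ae (ae_of_support p h)

lemma expect_pure (a : α) (f : α → ℝ) : expect (PMF.pure a) f = f a := by
  let : MeasurableSpace α := ⊤
  unfold expect
  rw [PMF.toMeasure_pure, integral_dirac]

lemma expect_map (p : PMF α) (g : α → β) (f : β → ℝ) :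
    expect (p.map g) f = expect p fun a => f (g a) := by
  let : MeasurableSpace α := ⊤
  let : MeasurableSpace β := ⊤
  unfold expect
  rw [← PMF.toMeasure_map g p measurable_from_top,
    integral_map measurable_from_top.aemeasurable measurable_from_top.aestronglyMeasurable]

lemma hasFiniteMean_map (p : PMF α) (g : α → β) (f : β → ℝ) :
    HasFiniteMean (p.map g) f ↔ HasFiniteMean p fun a => f (g a) := by
  let : MeasurableSpace α := ⊤
  let : MeasurableSpace β := ⊤
  unfold HasFiniteMean
  rw [← PMF.toMeasure_map g p measurable_from_top,
    integrable_map_measure measurable_from_top.aestronglyMeasurable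
      measurable_from_top.aemeasurable]
  rfl

lemma expect_bind [Countable α] {p : PMF α} {q : α → PMF β} {f : β → ℝ}
    (hf : HasFiniteMean (p.bind q) f) :
    expect (p.bind q) f = expect p fun a => expect (q a) f := by
  let : MeasurableSpace α := ⊤
  let : MeasurableSpace β := ⊤
  unfold expect
  unfold HasFiniteMean at hf
  let κ : ProbabilityTheory.Kernel α β := ⟨fun a => (q a).toMeasure, measurable_from_top⟩
  have h : (p.bind q).toMeasure = p.toMeasure.bind κ := toMeasure_bind p q
  rw [h, Measure.comp_eq_comp_const_apply] at hf ⊢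
  rw [ProbabilityTheory.Kernel.integral_comp hf, ProbabilityTheory.Kernel.const_apply]
  rfl

lemma ofReal_expect {p : PMF α} {f : α → ℝ} (hf : HasFiniteMean p f)
    (h : ∀ a ∈ p.support, 0 ≤ f a) :
    ENNReal.ofReal (expect p f) = lexpect p fun a => ENNReal.ofReal (f a) :=
  letI : MeasurableSpace α := ⊤
  ofReal_integral_eq_lintegral_ofReal hf (ae_of_support p h)

lemma hasFiniteMean_of_lexpect {p : PMF α} {f : α → ℝ} (hf : ∀ a, 0 ≤ f a)
    (h : lexpect p (fun a => ENNReal.ofReal (f a)) ≠ ∞) : HasFiniteMean p f := by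
  let : MeasurableSpace α := ⊤
  refine ⟨measurable_from_top.aestronglyMeasurable, ?_⟩
  rw [hasFiniteIntegral_iff_ofReal (Filter.Eventually.of_forall hf)]
  exact lt_top_iff_ne_top.2 h

lemma finite_support_bind {p : PMF α} {q : α → PMF β} (hp : p.support.Finite)
    (hq : ∀ a, (q a).support.Finite) : (p.bind q).support.Finite := by
  rw [PMF.support_bind]
  exact hp.biUnion fun a _ => hq a

lemma finite_support_map {p : PMF α} (g : α → β) (hp : p.support.Finite) :
    (p.map g).support.Finite := by
  rw [PMF.support_map]
  exact hp.image g

end Expectation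

/-! ### Drift conditions and equilibrium means for countable Markov chains. -/

section MarkovChain

variable {α : Type*}

/-- The `n`-step transition law of a Markov chain on a discrete space. -/
def iterStep (P : α → PMF α) : ℕ → α → PMF α
  | 0, z => PMF.pure z
  | n + 1, z => (P z).bind (iterStep P n)

lemma iterStep_succ' (P : α → PMF α) (n : ℕ) (z : α) :
    iterStep P (n + 1) z = (iterStep P n z).bind P := by
  induction n generalizing z with
  | zero => simp [iterStep]
  | succ n ih =>
    rw [iterStep, iterStep, PMF.bind_bind]
    congr 1
    funext y
    exact ih y

lemma bind_iterStep {P : α → PMF α} {ν : PMF α} (hν : ν.bind P = ν) (n : ℕ) :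
    ν.bind (iterStep P n) = ν := by
  induction n with
  | zero => exact PMF.bind_pure ν
  | succ n ih =>
    change (ν.bind fun z => (P z).bind (iterStep P n)) = ν
    rw [← PMF.bind_bind, hν, ih]

lemma mem_of_mem_support_iterStep {P : α → PMF α} {S : Set α}
    (hS : ∀ z ∈ S, ∀ z' ∈ (P z).support, z' ∈ S) (n : ℕ) {z : α} (hz : z ∈ S) {z' : α}
    (hz' : z' ∈ (iterStep P n z).support) : z' ∈ S := by
  induction n generalizing z with
  | zero => rw [iterStep, PMF.mem_support_pure_iff] at hz'; exact hz' ▸ hz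
  | succ n ih =>
    rw [iterStep, PMF.mem_support_bind_iff] at hz'
    obtain ⟨y, hy, hz'⟩ := hz'
    exact ih (hS z hz y hy) hz'

lemma abs_sub_le_of_mem_support_iterStep {P : α → PMF α} {S : Set α}
    (hS : ∀ z ∈ S, ∀ z' ∈ (P z).support, z' ∈ S) {V : α → ℝ} {D : ℝ}
    (hV : ∀ z ∈ S, ∀ z' ∈ (P z).support, |V z' - V z| ≤ D) (n : ℕ) {z : α} (hz : z ∈ S) {z' : α}
    (hz' : z' ∈ (iterStep P n z).support) : |V z' - V z| ≤ n * D := by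
  induction n generalizing z with
  | zero => rw [iterStep, PMF.mem_support_pure_iff] at hz'; simp [hz']
  | succ n ih =>
    rw [iterStep, PMF.mem_support_bind_iff] at hz'
    obtain ⟨y, hy, hz'⟩ := hz'
    have h1 := ih (hS z hz y hy) hz'
    have h2 := hV z hz y hy
    have h3 := abs_sub_le (V z') (V y) (V z)
    push_cast
    linarith

variable [Countable α]

/-- The one-step inequality telescopes along the chain. It is written additively because subtraction
is unsafe where `W` is infinite. -/
lemma lexpect_iterStep_add_sum_le {P : α → PMF α} {W f : α → ℝ≥0∞} {K : ℝ≥0∞}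
    (h : ∀ z, lexpect (P z) W + f z ≤ W z + K) (n : ℕ) (z : α) :
    lexpect (iterStep P n z) W + ∑ k ∈ Finset.range n, lexpect (iterStep P k z) f
      ≤ W z + n * K := by
  induction n generalizing z with
  | zero => simp [iterStep, lexpect_pure]
  | succ n ih =>
    rw [Finset.sum_range_succ']
    simp only [iterStep, lexpect_bind, lexpect_pure]
    rw [← add_assoc, ← lexpect_sum, ← lexpect_add]
    calc _ ≤ lexpect (P z) (fun y => W y + n * K) + f z := by
          gcongr
          exact lexpect_mono ih
      _ = lexpect (P z) W + f z + n * K := by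
          rw [lexpect_add, lexpect_const]; ring
      _ ≤ W z + K + n * K := add_le_add (h z) le_rfl
      _ = _ := by push_cast; ring

lemma lexpect_iterStep_of_stationary {P : α → PMF α} {ν : PMF α} (hν : ν.bind P = ν) (n : ℕ)
    (f : α → ℝ≥0∞) : lexpect ν (fun z => lexpect (iterStep P n z) f) = lexpect ν f := by
  rw [← lexpect_bind, bind_iterStep hν]

/-- If `W` has drift at most `-f + K`, then the mean of `f` is at most `K` in equilibrium. The
mean of `W` may be infinite. -/
theorem lexpect_le_of_drift {P : α → PMF α} {W f : α → ℝ≥0∞} {K : ℝ≥0∞}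
    (h : ∀ z, lexpect (P z) W + f z ≤ W z + K) {ν : PMF α} (hν : ν.bind P = ν)
    (hW : ∀ z ∈ ν.support, W z ≠ ∞) : lexpect ν f ≤ K := by
  let _ : MeasurableSpace α := ⊤
  -- By stationarity the mean of the truncated `f` equals the mean of its Cesàro averages along the
  -- chain. Given the initial state, such an average is at most `M`, and at most `W z / (n + 1) + K`
  -- by telescoping.
  have key (M n : ℕ) :
      lexpect ν (fun z => min (f z) M) ≤ lexpect ν fun z => min (M : ℝ≥0∞) (W z / (n + 1) + K) := by
    set g : α → ℝ≥0∞ := fun z => min (f z) M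
    have hn0 : ((n + 1 : ℕ) : ℝ≥0∞) ≠ 0 := by simp
    have hnt : ((n + 1 : ℕ) : ℝ≥0∞) ≠ ∞ := ENNReal.natCast_ne_top _
    have h1 : ((n + 1 : ℕ) : ℝ≥0∞) * lexpect ν g
        = lexpect ν fun z => ∑ k ∈ Finset.range (n + 1), lexpect (iterStep P k z) g := by
      rw [lexpect_sum]
      simp [lexpect_iterStep_of_stationary hν]
    have h2 : lexpect ν g = ((n + 1 : ℕ) : ℝ≥0∞)⁻¹ *
        lexpect ν fun z => ∑ k ∈ Finset.range (n + 1), lexpect (iterStep P k z) g := by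
      rw [← h1, ← mul_assoc, ENNReal.inv_mul_cancel hn0 hnt, one_mul]
    rw [h2, ← lexpect_const_mul]
    refine lexpect_mono fun z => le_min ?_ ?_
    · calc _ ≤ ((n + 1 : ℕ) : ℝ≥0∞)⁻¹ * ∑ k ∈ Finset.range (n + 1), (M : ℝ≥0∞) := by
            gcongr with k hk
            calc _ ≤ lexpect (iterStep P k z) fun _ => (M : ℝ≥0∞) :=
                  lexpect_mono fun z => min_le_right _ _
              _ = M := lexpect_const _ _
        _ = M := by
            rw [Finset.sum_const, Finset.card_range, nsmul_eq_mul, ← mul_assoc,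
              ENNReal.inv_mul_cancel hn0 hnt, one_mul]
    · calc _ ≤ ((n + 1 : ℕ) : ℝ≥0∞)⁻¹ * (W z + (n + 1 : ℕ) * K) := by
            gcongr
            calc _ ≤ ∑ k ∈ Finset.range (n + 1), lexpect (iterStep P k z) f := by
                  gcongr with k hk
                  exact lexpect_mono fun z => min_le_left _ _
              _ ≤ _ := le_trans le_add_self (lexpect_iterStep_add_sum_le h (n + 1) z)
        _ = _ := by
            rw [mul_add, ← mul_assoc, ENNReal.inv_mul_cancel hn0 hnt, one_mul, div_eq_mul_inv,
              mul_comm]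
            push_cast; rfl
  have hM (M : ℕ) : lexpect ν (fun z => min (f z) M) ≤ K := by
    -- The truncation at `M` supplies the dominating function, so it is enough that `W` is finite on
    -- the support of `ν`; integrability of `W` is never used.
    have hlim : Filter.Tendsto
        (fun n : ℕ => lexpect ν fun z => min (M : ℝ≥0∞) (W z / (n + 1) + K)) Filter.atTop
        (nhds (lexpect ν fun _ => min (M : ℝ≥0∞) K)) := by
      refine tendsto_lintegral_of_dominated_convergence (fun _ => (M : ℝ≥0∞))
        (fun _ => measurable_from_top) (fun n => Filter.Eventually.of_forall fun z => min_le_left _ _)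
        (by simp) (ae_of_support ν fun z hz => ?_)
      refine tendsto_const_nhds.min ?_
      have h0 : Filter.Tendsto (fun n : ℕ => W z / (n + 1)) Filter.atTop (nhds 0) := by
        have := (ENNReal.tendsto_inv_nat_nhds_zero.comp (Filter.tendsto_add_atTop_nat 1))
        have := ENNReal.Tendsto.const_mul (a := W z) this (Or.inr (hW z hz))
        simpa [div_eq_mul_inv, Function.comp_def] using this
      simpa using h0.add_const K
    have := le_of_tendsto_of_tendsto tendsto_const_nhds hlim (Filter.Eventually.of_forall (key M))
    rw [lexpect_const] at this
    exact this.trans (min_le_right _ _)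
  -- Monotone convergence removes the truncation.
  have hsup : lexpect ν f = ⨆ M : ℕ, lexpect ν fun z => min (f z) M := by
    unfold lexpect
    rw [← lintegral_iSup (fun _ => measurable_from_top)]
    · congr 1
      funext z
      rw [← inf_iSup_eq, ENNReal.iSup_natCast, inf_top_eq]
    · intro a b hab z
      exact min_le_min_left _ (by exact_mod_cast hab)
  rw [hsup]
  exact iSup_le hM

/-- A multi-step drift condition on an invariant set gives a one-step drift condition. -/
lemma exists_one_step_drift {P : α → PMF α} {S : Set α} {T : ℕ} (hT : 0 < T)
    (hS : ∀ z ∈ S, ∀ z' ∈ (P z).support, z' ∈ S) {V f : α → ℝ≥0∞} {K : ℝ≥0∞}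
    (hV : ∀ z ∈ S, ∀ k, lexpect (iterStep P k z) V ≠ ∞)
    (h : ∀ z ∈ S, lexpect (iterStep P T z) V + f z ≤ V z + K) :
    ∃ W : α → ℝ≥0∞, (∀ z ∈ S, W z ≠ ∞) ∧ ∀ z, lexpect (P z) W + f z ≤ W z + K := by
  classical
  -- The value `∞` off `S` makes the final inequality trivial there, so that it holds in every
  -- state.
  let V' : α → ℝ≥0∞ := fun z => if z ∈ S then V z else ∞
  have hV' (k : ℕ) {z : α} (hz : z ∈ S) :
      lexpect (iterStep P k z) V' = lexpect (iterStep P k z) V :=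
    lexpect_congr_support fun y hy => if_pos (mem_of_mem_support_iterStep hS k hz hy)
  -- One step of the chain shifts this sum by one index, so its one-step drift is the `T`-step drift
  -- of `V`.
  refine ⟨fun z => ∑ k ∈ Finset.range T, lexpect (iterStep P k z) V', ?_, ?_⟩
  · intro z hz
    refine ENNReal.sum_ne_top.2 fun k _ => ?_
    rw [hV' k hz]
    exact hV z hz k
  · intro z
    by_cases hz : z ∈ S
    · have h0 : V z ≠ ∞ := by simpa [iterStep, lexpect_pure] using hV z hz 0
      rw [lexpect_sum]
      have e1 : (∑ k ∈ Finset.range T, lexpect (P z) fun y => lexpect (iterStep P k y) V') + V z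
          = (∑ k ∈ Finset.range T, lexpect (iterStep P k z) V') + lexpect (iterStep P T z) V := by
        rw [← hV' T hz, ← Finset.sum_range_succ, Finset.sum_range_succ']
        simp [iterStep, lexpect_bind, lexpect_pure, V', hz]
      refine (ENNReal.add_le_add_iff_right h0).1 ?_
      calc _ = (∑ k ∈ Finset.range T, lexpect (P z) fun y => lexpect (iterStep P k y) V') + V z
              + f z := by ring
        _ = (∑ k ∈ Finset.range T, lexpect (iterStep P k z) V')
              + (lexpect (iterStep P T z) V + f z) := by rw [e1]; ring
        _ ≤ (∑ k ∈ Finset.range T, lexpect (iterStep P k z) V') + (V z + K) :=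
            add_le_add le_rfl (h z hz)
        _ = _ := by ring
    · have : ∑ k ∈ Finset.range T, lexpect (iterStep P k z) V' = ∞ := by
        -- The term `k = 0` is `V' z = ∞`; it is present since `T > 0`.
        refine ENNReal.sum_eq_top.2 ⟨0, Finset.mem_range.2 hT, ?_⟩
        simp [iterStep, lexpect_pure, V', hz]
      beta_reduce
      rw [this]
      simp

end MarkovChain

/-! ### Existence of stationary laws, and moment bounds from cubic drift. -/

section MarkovChain

variable {α : Type*}

/-- Both total masses are one, which leaves no room for a strict inequality. Stationarity of a limit
therefore needs only one inequality. -/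
lemma PMF_eq_of_le {p q : PMF α} (h : ∀ z, q z ≤ p z) : q = p := by
  ext z
  refine le_antisymm (h z) (not_lt.1 fun hlt => ?_)
  have := ENNReal.tsum_lt_tsum (by rw [q.tsum_coe]; simp) h hlt
  rw [q.tsum_coe, p.tsum_coe] at this
  exact lt_irrefl _ this

/-- The bound on `η E[V²]` in equilibrium given by the drift of `V³`, where the drift of `V²` over
several steps is at most `-2 η V + K`, and `V` changes by at most `D` over these steps. -/
def momentBound (η K D : ℝ) : ℝ := (3 / 2 * K + 3 / 2 * D ^ 2) ^ 2 / (8 * η) + D ^ 3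

/-- With `d = y - x` there is the identity `y ^ 3 = x ^ 3 + 3 / 2 * x * (y ^ 2 - x ^ 2) + 3 / 2 * x
* d ^ 2 + d ^ 3`. It expresses the change of the cube through that of the square, whose drift is
known. -/
lemma cube_le_of_abs_sub_le {x y D : ℝ} (hx : 0 ≤ x) (hD : |y - x| ≤ D) :
    y ^ 3 ≤ x ^ 3 + 3 / 2 * x * (y ^ 2 - x ^ 2) + 3 / 2 * x * D ^ 2 + D ^ 3 := by
  have h1 : (y - x) ^ 2 ≤ D ^ 2 := sq_le_sq' (abs_le.1 hD).1 (abs_le.1 hD).2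
  have h2 : (y - x) ^ 3 ≤ D ^ 3 := by
    have : Odd 3 := by decide
    exact this.strictMono_pow.monotone (le_of_abs_le hD)
  nlinarith [mul_le_mul_of_nonneg_left h1 hx]

lemma momentBound_nonneg {η K D : ℝ} (hη : 0 < η) (hD : 0 ≤ D) : 0 ≤ momentBound η K D := by
  unfold momentBound
  positivity

/-- The drift of the square, multiplied by `3 / 2 * V z`, contributes `-3 η V²`. One `η V²` is kept;
the other two absorb the terms linear in `V` by completing the square, which produces the first
summand of `momentBound`. -/
lemma cubic_drift {p : PMF α} {V : α → ℝ} {z : α} {η K D : ℝ} (hη : 0 < η) (hV : ∀ z, 0 ≤ V z)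
    (hD : ∀ z' ∈ p.support, |V z' - V z| ≤ D)
    (h : expect p (fun z' => V z' ^ 2) ≤ V z ^ 2 - 2 * η * V z + K) :
    expect p (fun z' => V z' ^ 3) + η * V z ^ 2 ≤ V z ^ 3 + momentBound η K D := by
  have hb : ∀ z' ∈ p.support, V z' ≤ V z + D := fun z' hz' => by
    linarith [(abs_le.1 (hD z' hz')).2]
  have hint (k : ℕ) : HasFiniteMean p fun z' => V z' ^ k :=
    hasFiniteMean_of_bounded ((V z + D) ^ k) fun z' hz' => by
      rw [abs_of_nonneg (pow_nonneg (hV z') k)]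
      exact pow_le_pow_left₀ (hV z') (hb z' hz') k
  set c := V z ^ 3 - 3 / 2 * V z ^ 3 + 3 / 2 * V z * D ^ 2 + D ^ 3
  have h1 : expect p (fun z' => V z' ^ 3)
      ≤ 3 / 2 * V z * expect p (fun z' => V z' ^ 2) + c := by
    rw [← expect_const_mul, ← expect_const p c,
      ← expect_add ((hint 2).const_mul _) (hasFiniteMean_const p c)]
    refine expect_mono (hint 3) (((hint 2).const_mul _).add (hasFiniteMean_const p c))
      fun z' hz' => ?_
    have := cube_le_of_abs_sub_le (hV z) (hD z' hz')
    simp only [c]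
    linarith
  have h2 := mul_le_mul_of_nonneg_left h (by have := hV z; positivity : 0 ≤ 3 / 2 * V z)
  have h3 : 0 ≤ 2 * η * (V z - (3 / 2 * K + 3 / 2 * D ^ 2) / (4 * η)) ^ 2 := by positivity
  have h4 : 2 * η * (V z - (3 / 2 * K + 3 / 2 * D ^ 2) / (4 * η)) ^ 2 = 2 * η * V z ^ 2
      - (3 / 2 * K + 3 / 2 * D ^ 2) * V z + (3 / 2 * K + 3 / 2 * D ^ 2) ^ 2 / (8 * η) := by
    field_simp
    ring
  unfold momentBound
  simp only [c] at h1
  linarith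

variable [Countable α]

/-- Foster's criterion: a chain with a drift function has a stationary distribution, without any
assumption of irreducibility. -/
theorem exists_stationary {P : α → PMF α} {W f : α → ℝ≥0∞} {K : ℝ≥0∞} (hK : K ≠ ∞)
    (h : ∀ z, lexpect (P z) W + f z ≤ W z + K) (hf : ∀ R : ℕ, {z | f z ≤ R}.Finite)
    {S : Set α} (hS : ∀ z ∈ S, ∀ z' ∈ (P z).support, z' ∈ S) {z₀ : α} (hz₀ : z₀ ∈ S)
    (hW : W z₀ ≠ ∞) : ∃ ν : PMF α, ν.support ⊆ S ∧ ν.bind P = ν := by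
  classical
  -- Cesàro averages of the laws of the chain started at `z₀`.
  let μ : ℕ → α → ℝ≥0∞ := fun n z =>
    ((n + 1 : ℕ) : ℝ≥0∞)⁻¹ * ∑ k ∈ Finset.range (n + 1), iterStep P k z₀ z
  have hn0 (n : ℕ) : ((n + 1 : ℕ) : ℝ≥0∞) ≠ 0 := by simp
  have hnt (n : ℕ) : ((n + 1 : ℕ) : ℝ≥0∞) ≠ ∞ := ENNReal.natCast_ne_top _
  have hμ (n : ℕ) (g : α → ℝ≥0∞) : ∑' z, μ n z * g z
      = ((n + 1 : ℕ) : ℝ≥0∞)⁻¹ * ∑ k ∈ Finset.range (n + 1), lexpect (iterStep P k z₀) g := by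
    simp only [μ, mul_assoc, ENNReal.tsum_mul_left, Finset.sum_mul, lexpect_eq_tsum]
    rw [Summable.tsum_finsetSum fun _ _ => ENNReal.summable]
  have hμ1 (n : ℕ) : ∑' z, μ n z = 1 := by
    have := hμ n fun _ => 1
    simp only [mul_one, lexpect_const, Finset.sum_const, Finset.card_range, nsmul_eq_mul] at this
    rw [this, ENNReal.inv_mul_cancel (hn0 n) (hnt n)]
  set C := W z₀ + K
  have hC : C ≠ ∞ := ENNReal.add_ne_top.2 ⟨hW, hK⟩
  have hμf (n : ℕ) : ∑' z, μ n z * f z ≤ C := by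
    rw [hμ]
    calc _ ≤ ((n + 1 : ℕ) : ℝ≥0∞)⁻¹ * (W z₀ + (n + 1 : ℕ) * K) := by
          gcongr
          exact le_trans le_add_self (lexpect_iterStep_add_sum_le h (n + 1) z₀)
      _ = ((n + 1 : ℕ) : ℝ≥0∞)⁻¹ * W z₀ + K := by
          rw [mul_add, ← mul_assoc, ENNReal.inv_mul_cancel (hn0 n) (hnt n), one_mul]
      _ ≤ 1 * W z₀ + K := by
          gcongr
          rw [ENNReal.inv_le_one]
          exact_mod_cast Nat.succ_pos n
      _ = C := by rw [one_mul]
  -- A step of the chain shifts the averaging window by one, which adds at most one term of size one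
  -- before normalization.
  have hμP (n : ℕ) (z : α) : ∑' x, μ n x * P x z ≤ μ n z + ((n + 1 : ℕ) : ℝ≥0∞)⁻¹ := by
    have hk (k : ℕ) : lexpect (iterStep P k z₀) (fun x => P x z) = iterStep P (k + 1) z₀ z := by
      rw [iterStep_succ', PMF.bind_apply, lexpect_eq_tsum]
    rw [hμ]
    simp only [hk, μ]
    calc _ ≤ ((n + 1 : ℕ) : ℝ≥0∞)⁻¹ * (∑ k ∈ Finset.range (n + 1), iterStep P k z₀ z + 1) := by
          gcongr
          calc _ ≤ ∑ k ∈ Finset.range (n + 1 + 1), iterStep P k z₀ z := by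
                rw [Finset.sum_range_succ' _ (n + 1)]
                exact le_self_add
            _ ≤ _ := by
                rw [Finset.sum_range_succ]
                gcongr
                exact PMF.coe_le_one _ _
      _ = _ := by rw [mul_add, mul_one]
  -- Along an ultrafilter every pointwise sequence in the compact space `ℝ≥0∞` converges, so no
  -- diagonal subsequence is needed.
  have hU : ((Filter.hyperfilter ℕ : Ultrafilter ℕ) : Filter ℕ) ≤ Filter.atTop :=
    Nat.hyperfilter_le_atTop
  set U : Filter ℕ := ((Filter.hyperfilter ℕ : Ultrafilter ℕ) : Filter ℕ)
  have hlim (z : α) : ∃ a, Filter.Tendsto (fun n => μ n z) U (nhds a) := by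
    obtain ⟨a, -, ha⟩ := (isCompact_univ (X := ℝ≥0∞)).ultrafilter_le_nhds
      ((Filter.hyperfilter ℕ).map fun n => μ n z) (by simp)
    exact ⟨a, ha⟩
  choose ν hν using hlim
  have hsum (F : Finset α) (g : α → ℝ≥0∞) (hg : ∀ z, g z ≠ ∞) :
      Filter.Tendsto (fun n => ∑ z ∈ F, μ n z * g z) U (nhds (∑ z ∈ F, ν z * g z)) :=
    tendsto_finsetSum _ fun z _ => ENNReal.Tendsto.mul_const (hν z) (Or.inr (hg z))
  have hν_le : ∑' z, ν z ≤ 1 := by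
    rw [ENNReal.tsum_eq_iSup_sum]
    refine iSup_le fun F => ?_
    have := hsum F (fun _ => 1) (by simp)
    simp only [mul_one] at this
    exact le_of_tendsto' this fun n => (ENNReal.sum_le_tsum F).trans (hμ1 n).le
  -- Tightness: by Markov's inequality the averages put mass at most `C / (R + 1)` outside the
  -- finite set where `f ≤ R + 1`, so no mass escapes in the limit.
  have hν_ge (R : ℕ) : 1 ≤ ∑' z, ν z + ((R + 1 : ℕ) : ℝ≥0∞)⁻¹ * C := by
    set F := (hf (R + 1)).toFinset
    have h1 (n : ℕ) : 1 ≤ ∑ z ∈ F, μ n z + ((R + 1 : ℕ) : ℝ≥0∞)⁻¹ * C := by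
      calc 1 = ∑' z, μ n z := (hμ1 n).symm
        _ ≤ ∑' z, ((if z ∈ F then μ n z else 0) + ((R + 1 : ℕ) : ℝ≥0∞)⁻¹ * (μ n z * f z)) := by
            refine ENNReal.tsum_le_tsum fun z => ?_
            by_cases hz : z ∈ F
            · simp [hz]
            · rw [if_neg hz, zero_add]
              have hz' : ((R + 1 : ℕ) : ℝ≥0∞) ≤ f z := by
                simp only [F, Set.Finite.mem_toFinset, Set.mem_ofPred_eq, not_le] at hz
                exact hz.le
              calc μ n z = ((R + 1 : ℕ) : ℝ≥0∞)⁻¹ * (μ n z * (R + 1 : ℕ)) := by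
                    rw [mul_comm, mul_assoc, ENNReal.mul_inv_cancel (hn0 R) (hnt R), mul_one]
                _ ≤ _ := by gcongr
        _ = ∑ z ∈ F, μ n z + ((R + 1 : ℕ) : ℝ≥0∞)⁻¹ * ∑' z, μ n z * f z := by
            rw [ENNReal.tsum_add, ENNReal.tsum_mul_left, tsum_eq_sum (s := F)]
            · congr 1
              exact Finset.sum_congr rfl fun z hz => if_pos hz
            · intro z hz
              exact if_neg hz
        _ ≤ _ := by gcongr; exact hμf n
    have h2 := (hsum F (fun _ => 1) (by simp)).add_const (((R + 1 : ℕ) : ℝ≥0∞)⁻¹ * C)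
    simp only [mul_one] at h2
    calc 1 ≤ ∑ z ∈ F, ν z + ((R + 1 : ℕ) : ℝ≥0∞)⁻¹ * C := ge_of_tendsto' h2 h1
      _ ≤ _ := by gcongr; exact ENNReal.sum_le_tsum F
  have hν1 : ∑' z, ν z = 1 := by
    refine le_antisymm hν_le ?_
    have h0 : Filter.Tendsto (fun R : ℕ => ((R + 1 : ℕ) : ℝ≥0∞)⁻¹) Filter.atTop (nhds 0) :=
      ENNReal.tendsto_inv_nat_nhds_zero.comp (Filter.tendsto_add_atTop_nat 1)
    have h1 := (ENNReal.Tendsto.mul_const (b := C) h0 (Or.inr hC)).const_add (∑' z, ν z)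
    simp only [zero_mul, add_zero] at h1
    exact ge_of_tendsto' h1 hν_ge
  let p : PMF α := ⟨ν, hν1 ▸ ENNReal.summable.hasSum⟩
  refine ⟨p, ?_, PMF_eq_of_le fun z => ?_⟩
  · intro z hz
    by_contra hzS
    refine hz (tendsto_nhds_unique (hν z) ?_)
    have : ∀ n, μ n z = 0 := fun n => by
      simp only [μ, mul_eq_zero, Finset.sum_eq_zero_iff]
      refine Or.inr fun k _ => ?_
      rw [PMF.apply_eq_zero_iff]
      exact fun hz' => hzS (mem_of_mem_support_iterStep hS k hz₀ hz')
    simp only [this]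
    exact tendsto_const_nhds
  -- Finite partial sums pass to the limit, which gives the inequality that `PMF_eq_of_le` turns
  -- into stationarity.
  · rw [PMF.bind_apply]
    change ∑' x, ν x * P x z ≤ ν z
    rw [ENNReal.tsum_eq_iSup_sum]
    refine iSup_le fun F => ?_
    have h0 : Filter.Tendsto (fun n : ℕ => ((n + 1 : ℕ) : ℝ≥0∞)⁻¹) U (nhds 0) :=
      (ENNReal.tendsto_inv_nat_nhds_zero.comp (Filter.tendsto_add_atTop_nat 1)).mono_left hU
    have h1 := (hν z).add h0
    rw [add_zero] at h1
    exact le_of_tendsto_of_tendsto' (hsum F (fun x => P x z) fun x => PMF.apply_ne_top _ _) h1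
      fun n => (ENNReal.sum_le_tsum F).trans (hμP n z)

/-- A multi-step drift condition for `V²`, where `V` has bounded increments, gives a one-step drift
condition with drift `-η V²`. -/
lemma exists_quadratic_drift {P : α → PMF α} {S : Set α} {T : ℕ} (hT : 0 < T)
    (hS : ∀ z ∈ S, ∀ z' ∈ (P z).support, z' ∈ S) {V : α → ℝ} {η K D : ℝ} (hη : 0 < η)
    (hD0 : 0 ≤ D) (hV : ∀ z, 0 ≤ V z) (hD : ∀ z ∈ S, ∀ z' ∈ (P z).support, |V z' - V z| ≤ D)
    (h : ∀ z ∈ S, expect (iterStep P T z) (fun z' => V z' ^ 2) ≤ V z ^ 2 - 2 * η * V z + K)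
    {f : α → ℝ≥0∞} (hf : ∀ z ∈ S, f z = ENNReal.ofReal (η * V z ^ 2)) :
    ∃ W : α → ℝ≥0∞, (∀ z ∈ S, W z ≠ ∞) ∧
      ∀ z, lexpect (P z) W + f z ≤ W z + ENNReal.ofReal (momentBound η K (T * D)) := by
  have hinc (n : ℕ) {z : α} (hz : z ∈ S) := fun z' (hz' : z' ∈ (iterStep P n z).support) =>
    abs_sub_le_of_mem_support_iterStep hS hD n hz hz'
  have hint (n : ℕ) {z : α} (hz : z ∈ S) :
      HasFiniteMean (iterStep P n z) fun z' => V z' ^ 3 :=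
    hasFiniteMean_of_bounded ((V z + n * D) ^ 3) fun z' hz' => by
      rw [abs_of_nonneg (pow_nonneg (hV z') 3)]
      exact pow_le_pow_left₀ (hV z') (by linarith [(abs_le.1 (hinc n hz z' hz')).2]) 3
  have hexp (n : ℕ) {z : α} (hz : z ∈ S) :=
    ofReal_expect (hint n hz) fun z' _ => pow_nonneg (hV z') 3
  refine exists_one_step_drift hT hS (V := fun z => ENNReal.ofReal (V z ^ 3)) ?_ ?_
  · intro z hz k
    rw [← hexp k hz]
    exact ENNReal.ofReal_ne_top
  · intro z hz
    rw [← hexp T hz, hf z hz, ← ENNReal.ofReal_add, ← ENNReal.ofReal_add]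
    · exact ENNReal.ofReal_le_ofReal (cubic_drift hη hV (hinc T hz) (h z hz))
    · exact pow_nonneg (hV z) 3
    · exact momentBound_nonneg hη (by positivity)
    · exact expect_nonneg fun z' _ => pow_nonneg (hV z') 3
    · positivity

theorem exists_stationary_of_drift {P : α → PMF α} {S : Set α} {T : ℕ} (hT : 0 < T)
    (hS : ∀ z ∈ S, ∀ z' ∈ (P z).support, z' ∈ S) (hne : S.Nonempty) {V : α → ℝ} {η K D : ℝ}
    (hη : 0 < η) (hD0 : 0 ≤ D) (hV : ∀ z, 0 ≤ V z)
    (hD : ∀ z ∈ S, ∀ z' ∈ (P z).support, |V z' - V z| ≤ D)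
    (h : ∀ z ∈ S, expect (iterStep P T z) (fun z' => V z' ^ 2) ≤ V z ^ 2 - 2 * η * V z + K)
    (hfin : ∀ R : ℝ, {z | V z ≤ R}.Finite) :
    ∃ ν : PMF α, ν.support ⊆ S ∧ ν.bind P = ν := by
  obtain ⟨W, hW, hdrift⟩ := exists_quadratic_drift hT hS hη hD0 hV hD h
    (f := fun z => ENNReal.ofReal (η * V z ^ 2)) fun _ _ => rfl
  obtain ⟨z₀, hz₀⟩ := hne
  refine exists_stationary ENNReal.ofReal_ne_top hdrift (fun R => ?_) hS hz₀ (hW z₀ hz₀)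
  refine (hfin (Real.sqrt (R / η))).subset fun z hz => ?_
  have hz' : η * V z ^ 2 ≤ R := by
    have : ENNReal.ofReal (η * V z ^ 2) ≤ R := hz
    rwa [← ENNReal.ofReal_natCast, ENNReal.ofReal_le_ofReal_iff (Nat.cast_nonneg R)] at this
  refine Real.le_sqrt_of_sq_le ?_
  rw [le_div_iff₀ hη]
  linarith

/-- No moment of `ν` is presupposed: the cubic drift is fed to `lexpect_le_of_drift`, which allows
the Lyapunov function to have infinite mean. The bound depends only on `T`, `η`, `K` and `D`. -/
theorem second_moment_of_drift {P : α → PMF α} {S : Set α} {T : ℕ} (hT : 0 < T)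
    (hS : ∀ z ∈ S, ∀ z' ∈ (P z).support, z' ∈ S) {V : α → ℝ} {η K D : ℝ} (hη : 0 < η)
    (hD0 : 0 ≤ D) (hV : ∀ z, 0 ≤ V z) (hD : ∀ z ∈ S, ∀ z' ∈ (P z).support, |V z' - V z| ≤ D)
    (h : ∀ z ∈ S, expect (iterStep P T z) (fun z' => V z' ^ 2) ≤ V z ^ 2 - 2 * η * V z + K)
    {ν : PMF α} (hνS : ν.support ⊆ S) (hν : ν.bind P = ν) :
    HasFiniteMean ν (fun z => V z ^ 2) ∧
      expect ν (fun z => V z ^ 2) ≤ momentBound η K (T * D) / η := by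
  obtain ⟨W, hW, hdrift⟩ := exists_quadratic_drift hT hS hη hD0 hV hD h
    (f := fun z => ENNReal.ofReal (η * V z ^ 2)) fun _ _ => rfl
  have hle := lexpect_le_of_drift hdrift hν fun z hz => hW z (hνS hz)
  have hpos : ∀ z, 0 ≤ η * V z ^ 2 := fun z => by positivity
  have hint := hasFiniteMean_of_lexpect hpos (ne_top_of_le_ne_top ENNReal.ofReal_ne_top hle)
  have hint' : HasFiniteMean ν fun z => V z ^ 2 :=
    (hint.const_mul η⁻¹).congr fun z _ => by field_simp
  refine ⟨hint', ?_⟩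
  rw [← ofReal_expect hint fun z _ => hpos z, ENNReal.ofReal_le_ofReal_iff
    (momentBound_nonneg hη (by positivity)), expect_const_mul] at hle
  rw [le_div_iff₀ hη]
  linarith

end MarkovChain

/-! ### The heavy-traffic estimate common to both queueing systems. -/

/-- The quadratic Lyapunov argument in equilibrium. The queue length `x` changes by the net input
`d` and the unused service, and `x · (unused service)` after a step is bounded with the help of a
function `w` whose second moment is at most `C`. -/
theorem heavy_traffic_bounds {α β : Type*} [Countable α] {ν : PMF α} {κ : α → PMF β}
    {next : α → β → α} (hν : (ν.bind fun z => (κ z).map (next z)) = ν) {x w : α → ℝ}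
    (hx : ∀ z, 0 ≤ x z) (hx2 : HasFiniteMean ν fun z => x z ^ 2) {d : β → ℝ} {B ε v C : ℝ}
    (hε : 0 < ε) (hd : ∀ z, ∀ b ∈ (κ z).support, |d b| ≤ B) {u : α → β → ℝ}
    (hu : ∀ z, ∀ b ∈ (κ z).support, x (next z b) = x z + d b + u z b)
    (hu0 : ∀ z, ∀ b ∈ (κ z).support, 0 ≤ u z b) (huB : ∀ z, ∀ b ∈ (κ z).support, u z b ≤ B)
    (hmean : ∀ z, expect (κ z) d = -ε) (hvar : ∀ z, expect (κ z) (fun b => d b ^ 2) = v)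
    (hw2 : HasFiniteMean ν fun z => w z ^ 2) (hwC : expect ν (fun z => w z ^ 2) ≤ C)
    (hxw : ∀ z, ∀ b ∈ (κ z).support, x (next z b) * u z b ≤ w (next z b) * u z b) :
    v - B * ε ≤ 2 * (ε * expect ν x) ∧
      2 * (ε * expect ν x) ≤ v + Real.sqrt ε * (2 * C + B / 2) := by
  -- The joint law of the state and the events of a slot. The states before and after the slot both
  -- have law `ν` under it.
  let J : PMF (α × β) := ν.bind fun z => (κ z).map fun b => (z, b)
  have hJ : ∀ p ∈ J.support, p.2 ∈ (κ p.1).support := by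
    rintro ⟨z, b⟩ hp
    simp only [J, PMF.mem_support_bind_iff, PMF.support_map, Set.mem_image, Prod.mk.injEq] at hp
    obtain ⟨z', -, b', hb', rfl, rfl⟩ := hp
    exact hb'
  have hfst : J.map Prod.fst = ν := by
    simp only [J, PMF.map_bind, PMF.map_comp]
    conv_rhs => rw [← PMF.bind_pure ν]
    congr 1
    funext z
    exact PMF.map_const _ z
  have hnext : J.map (fun p => next p.1 p.2) = ν := by
    conv_rhs => rw [← hν]
    simp only [J, PMF.map_bind, PMF.map_comp]
    rfl
  have hE {f : α × β → ℝ} (hf : HasFiniteMean J f) :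
      expect J f = expect ν fun z => expect (κ z) fun b => f (z, b) := by
    rw [expect_bind hf]
    simp only [expect_map]
  have hEfst (f : α → ℝ) : expect J (fun p => f p.1) = expect ν f := by
    rw [← expect_map J Prod.fst f, hfst]
  have hEnext (f : α → ℝ) : expect J (fun p => f (next p.1 p.2)) = expect ν f := by
    rw [← expect_map J (fun p => next p.1 p.2) f, hnext]
  have hIfst {f : α → ℝ} (hf : HasFiniteMean ν f) : HasFiniteMean J fun p => f p.1 := by
    rwa [← hasFiniteMean_map J Prod.fst f, hfst]
  have hInext {f : α → ℝ} (hf : HasFiniteMean ν f) :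
      HasFiniteMean J fun p => f (next p.1 p.2) := by
    rwa [← hasFiniteMean_map J (fun p => next p.1 p.2) f, hnext]
  have hx1 : HasFiniteMean ν x := hasFiniteMean_of_sq hx2
  have Id : HasFiniteMean J fun p => d p.2 :=
    hasFiniteMean_of_bounded B fun p hp => hd p.1 p.2 (hJ p hp)
  have Iu : HasFiniteMean J fun p => u p.1 p.2 := hasFiniteMean_of_bounded B fun p hp => by
    rw [abs_of_nonneg (hu0 _ _ (hJ p hp))]
    exact huB _ _ (hJ p hp)
  have hd2B : ∀ p ∈ J.support, d p.2 ^ 2 ≤ B ^ 2 := fun p hp =>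
    sq_le_sq' (abs_le.1 (hd _ _ (hJ p hp))).1 (abs_le.1 (hd _ _ (hJ p hp))).2
  have hu2B : ∀ p ∈ J.support, u p.1 p.2 ^ 2 ≤ B * u p.1 p.2 := fun p hp => by
    nlinarith [hu0 _ _ (hJ p hp), huB _ _ (hJ p hp)]
  have Id2 : HasFiniteMean J fun p => d p.2 ^ 2 :=
    hasFiniteMean_of_bounded (B ^ 2) fun p hp => by
      rw [abs_of_nonneg (sq_nonneg _)]
      exact hd2B p hp
  have Iu2 : HasFiniteMean J fun p => u p.1 p.2 ^ 2 := (Iu.const_mul B).mono fun p hp => by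
    rw [abs_of_nonneg (sq_nonneg _)]
    exact hu2B p hp
  have Ixd : HasFiniteMean J fun p => x p.1 * d p.2 :=
    ((hIfst hx2).add Id2).mono fun p _ => by
      rw [abs_le]
      constructor <;> nlinarith [sq_nonneg (x p.1 - d p.2), sq_nonneg (x p.1 + d p.2)]
  have Ixu : HasFiniteMean J fun p => x (next p.1 p.2) * u p.1 p.2 :=
    ((hInext hx2).add Iu2).mono fun p _ => by
      rw [abs_le]
      constructor <;> nlinarith [sq_nonneg (x (next p.1 p.2) - u p.1 p.2),
        sq_nonneg (x (next p.1 p.2) + u p.1 p.2)]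
  have Ed : expect J (fun p => d p.2) = -ε := by
    rw [hE Id]
    simp only [hmean, expect_const]
  have Ed2 : expect J (fun p => d p.2 ^ 2) = v := by
    rw [hE Id2]
    simp only [hvar, expect_const]
  have Exd : expect J (fun p => x p.1 * d p.2) = -ε * expect ν x := by
    rw [hE Ixd, ← expect_const_mul]
    simp only [expect_const_mul, hmean, mul_comm]
  -- Zero drift of `x` in equilibrium: the mean unused service balances the mean net input `-ε`.
  have Eu : expect J (fun p => u p.1 p.2) = ε := by
    have h1 : expect J (fun p => x (next p.1 p.2))
        = expect J fun p => x p.1 + d p.2 + u p.1 p.2 :=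
      expect_congr fun p hp => hu _ _ (hJ p hp)
    rw [expect_add ((hIfst hx1).add Id) Iu, expect_add (hIfst hx1) Id, hEnext, hEfst, Ed] at h1
    linarith
  have Eu2 : expect J (fun p => u p.1 p.2 ^ 2) ≤ B * ε := by
    rw [← Eu, ← expect_const_mul]
    exact expect_mono Iu2 (Iu.const_mul B) hu2B
  have Eu2' : 0 ≤ expect J (fun p => u p.1 p.2 ^ 2) := expect_nonneg fun _ _ => sq_nonneg _
  have Exu : 0 ≤ expect J fun p => x (next p.1 p.2) * u p.1 p.2 :=
    expect_nonneg fun p hp => mul_nonneg (hx _) (hu0 _ _ (hJ p hp))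
  -- Zero drift of `x ^ 2`, from squaring `x' - u = x + d`; its finite mean lets the two copies
  -- cancel.
  have hbal : 2 * (ε * expect ν x) = v + 2 * expect J (fun p => x (next p.1 p.2) * u p.1 p.2)
      - expect J (fun p => u p.1 p.2 ^ 2) := by
    have h1 : expect J (fun p => x (next p.1 p.2) ^ 2 + u p.1 p.2 ^ 2)
        = expect J fun p => x p.1 ^ 2 + 2 * (x p.1 * d p.2) + d p.2 ^ 2
          + 2 * (x (next p.1 p.2) * u p.1 p.2) :=
      expect_congr fun p hp => by
        rw [hu _ _ (hJ p hp)]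
        ring
    rw [expect_add (hInext hx2) Iu2, expect_add (((hIfst hx2).add (Ixd.const_mul 2)).add Id2)
      (Ixu.const_mul 2), expect_add ((hIfst hx2).add (Ixd.const_mul 2)) Id2,
      expect_add (hIfst hx2) (Ixd.const_mul 2), expect_const_mul, expect_const_mul,
      hEnext fun z => x z ^ 2, hEfst fun z => x z ^ 2, Exd, Ed2] at h1
    linarith
  have hs : 0 < Real.sqrt ε := Real.sqrt_pos.2 hε
  have hss : Real.sqrt ε * Real.sqrt ε = ε := Real.mul_self_sqrt hε.le
  -- Young's inequality `w u ≤ √ε w² + u² / (4 √ε)`. Since `E[u²] ≤ B ε`, this weight makes both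
  -- terms of order `√ε`.
  have Exu' : expect J (fun p => x (next p.1 p.2) * u p.1 p.2)
      ≤ Real.sqrt ε * C + 1 / (4 * Real.sqrt ε) * (B * ε) := by
    calc _ ≤ expect J fun p => Real.sqrt ε * w (next p.1 p.2) ^ 2
            + 1 / (4 * Real.sqrt ε) * u p.1 p.2 ^ 2 := by
          refine expect_mono Ixu (((hInext hw2).const_mul _).add (Iu2.const_mul _))
            fun p hp => (hxw _ _ (hJ p hp)).trans ?_
          have h1 : 0 ≤ Real.sqrt ε
              * (w (next p.1 p.2) - 1 / (2 * Real.sqrt ε) * u p.1 p.2) ^ 2 := by positivity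
          have h2 : Real.sqrt ε * (w (next p.1 p.2) - 1 / (2 * Real.sqrt ε) * u p.1 p.2) ^ 2
              = Real.sqrt ε * w (next p.1 p.2) ^ 2 + 1 / (4 * Real.sqrt ε) * u p.1 p.2 ^ 2
                - w (next p.1 p.2) * u p.1 p.2 := by
            field_simp
            ring
          linarith
      _ = Real.sqrt ε * expect ν (fun z => w z ^ 2)
            + 1 / (4 * Real.sqrt ε) * expect J (fun p => u p.1 p.2 ^ 2) := by
          rw [expect_add ((hInext hw2).const_mul _) (Iu2.const_mul _), expect_const_mul,
            expect_const_mul, hEnext fun z => w z ^ 2]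
      _ ≤ _ := by gcongr
  have h3 : 1 / (4 * Real.sqrt ε) * (B * ε) = Real.sqrt ε * B / 4 := by
    rw [← hss]
    field_simp
    simp [Real.sqrt_sq hs.le]
  constructor <;> nlinarith

instance {N : ℕ} : Countable (State N) :=
  Function.Injective.countable (f := fun Z : State N => (Z.queue, Z.memory)) fun Z Z' h => by
    simp only [Prod.mk.injEq] at h
    exact State.ext h.1 h.2

instance {N : ℕ} : Countable (Slot N) :=
  Function.Injective.countable
    (f := fun ω : Slot N => (ω.arrivals, ω.dest, ω.service, ω.newMemory)) fun ω ω' h => by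
    simp only [Prod.mk.injEq] at h
    exact Slot.ext h.1 h.2.1 h.2.2.1 h.2.2.2

/-! ### Moments of the arrivals and services in a slot. -/

section Noise

variable {N : ℕ} {arrival : PMF ℕ} {service : Fin N → PMF ℕ} {Amax Smax : ℕ}

lemma mem_support_of_mem_support_serviceLaw {S : Fin N → ℕ}
    (hS : S ∈ (serviceLaw service).support) (n : Fin N) : S n ∈ (service n).support := by
  rw [PMF.mem_support_iff, serviceLaw, Measure.toPMF_apply, Measure.pi_singleton,
    Finset.prod_ne_zero_iff] at hS
  have := hS n (Finset.mem_univ n)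
  rwa [PMF.toMeasure_apply_singleton _ _ (MeasurableSet.singleton _)] at this

lemma map_eval_serviceLaw (service : Fin N → PMF ℕ) (n : Fin N) :
    (serviceLaw service).map (fun S => S n) = service n := by
  apply PMF.toMeasure_injective
  rw [← PMF.toMeasure_map _ _ (measurable_pi_apply n), serviceLaw, Measure.toPMF_toMeasure]
  exact (measurePreserving_eval (fun n => (service n).toMeasure) n).map_eq

/-- The joint law of the arrivals and the services of a slot. -/
def noiseLaw (arrival : PMF ℕ) (service : Fin N → PMF ℕ) : PMF (ℕ × (Fin N → ℕ)) :=
  arrival.bind fun a => (serviceLaw service).map fun S => (a, S)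

lemma mem_support_noiseLaw {p : ℕ × (Fin N → ℕ)} (hp : p ∈ (noiseLaw arrival service).support) :
    p.1 ∈ arrival.support ∧ p.2 ∈ (serviceLaw service).support := by
  simp only [noiseLaw, PMF.mem_support_bind_iff, PMF.support_map, Set.mem_image] at hp
  obtain ⟨a, ha, S, hS, rfl⟩ := hp
  exact ⟨ha, hS⟩

lemma finite_support_serviceLaw (hS : ∀ n, ∀ k ∈ (service n).support, k ≤ Smax) :
    (serviceLaw service).support.Finite :=
  (Set.finite_Icc (0 : Fin N → ℕ) fun _ => Smax).subset fun _ h =>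
    ⟨fun _ => Nat.zero_le _, fun n => hS n _ (mem_support_of_mem_support_serviceLaw h n)⟩

lemma finite_support_nat {p : PMF ℕ} {m : ℕ} (h : ∀ a ∈ p.support, a ≤ m) : p.support.Finite :=
  (Set.finite_Iic m).subset h

lemma finite_support_noiseLaw (hA : ∀ a ∈ arrival.support, a ≤ Amax)
    (hS : ∀ n, ∀ k ∈ (service n).support, k ≤ Smax) :
    (noiseLaw arrival service).support.Finite :=
  finite_support_bind (finite_support_nat hA) fun _ =>
    finite_support_map _ (finite_support_serviceLaw hS)

lemma expect_sum_serviceLaw (hS : ∀ n, ∀ k ∈ (service n).support, k ≤ Smax) :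
    expect (serviceLaw service) (fun S => ∑ n, (S n : ℝ))
      = ∑ n, expect (service n) fun k => (k : ℝ) := by
  have key (s : Finset (Fin N)) : expect (serviceLaw service) (fun S => ∑ n ∈ s, (S n : ℝ))
      = ∑ n ∈ s, expect (service n) fun k => (k : ℝ) := by
    classical
    induction s using Finset.induction_on with
    | empty => simp [expect_const]
    | insert n s hn ih =>
      simp only [Finset.sum_insert hn]
      rw [expect_add (hasFiniteMean_of_finite (finite_support_serviceLaw hS) _)
        (hasFiniteMean_of_finite (finite_support_serviceLaw hS) _), ih]
      congr 1
      rw [← expect_map (serviceLaw service) (fun S => S n) fun k => (k : ℝ), map_eval_serviceLaw]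
  exact key Finset.univ

/-- The net input of a slot, the arrivals minus all the offered services. -/
def netInput (p : ℕ × (Fin N → ℕ)) : ℝ := (p.1 : ℝ) - ∑ n, (p.2 n : ℝ)

lemma expect_noiseLaw (hA : ∀ a ∈ arrival.support, a ≤ Amax)
    (hS : ∀ n, ∀ k ∈ (service n).support, k ≤ Smax) (f : ℕ × (Fin N → ℕ) → ℝ) :
    expect (noiseLaw arrival service) f
      = expect arrival fun a => expect (serviceLaw service) fun S => f (a, S) := by
  have hf := hasFiniteMean_of_finite (finite_support_noiseLaw hA hS) f
  unfold noiseLaw at hf ⊢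
  rw [expect_bind hf]
  simp only [expect_map]

lemma expect_netInput (hA : ∀ a ∈ arrival.support, a ≤ Amax)
    (hS : ∀ n, ∀ k ∈ (service n).support, k ≤ Smax) :
    expect (noiseLaw arrival service) netInput
      = expect arrival (fun a => (a : ℝ)) - ∑ n, expect (service n) fun k => (k : ℝ) := by
  have hfS := finite_support_serviceLaw hS
  have hfA := finite_support_nat hA
  rw [expect_noiseLaw hA hS]
  simp only [netInput, sub_eq_add_neg, neg_eq_neg_one_mul (∑ n, _ : ℝ)]
  simp only [expect_add (hasFiniteMean_of_finite hfS _) (hasFiniteMean_of_finite hfS _),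
    expect_add (hasFiniteMean_of_finite hfA _) (hasFiniteMean_of_finite hfA _),
    expect_const_mul, expect_const, expect_sum_serviceLaw hS]

lemma natVariance_eq (hA : ∀ a ∈ arrival.support, a ≤ Amax) :
    natVariance arrival
      = expect arrival (fun a => (a : ℝ) ^ 2) - expect arrival (fun a => (a : ℝ)) ^ 2 := by
  refine ProbabilityTheory.variance_eq_sub (MemLp.of_bound
    measurable_from_top.aestronglyMeasurable Amax (ae_of_support arrival fun a ha => ?_))
  rw [Real.norm_of_nonneg (Nat.cast_nonneg a)]
  exact_mod_cast hA a ha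

/-- Only the independence of the arrivals from the services is used. The second moment of the total
service stays unexpanded, as it does not depend on the arrival law. -/
lemma expect_netInput_sq (hA : ∀ a ∈ arrival.support, a ≤ Amax)
    (hS : ∀ n, ∀ k ∈ (service n).support, k ≤ Smax) :
    expect (noiseLaw arrival service) (fun p => netInput p ^ 2)
      = natVariance arrival + expect arrival (fun a => (a : ℝ)) ^ 2
        - 2 * (∑ n, expect (service n) fun k => (k : ℝ)) * expect arrival (fun a => (a : ℝ))
        + expect (serviceLaw service) fun S => (∑ n, (S n : ℝ)) ^ 2 := by
  have hfS := finite_support_serviceLaw hS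
  have hfA := finite_support_nat hA
  rw [expect_noiseLaw hA hS, natVariance_eq hA]
  have h (a : ℕ) (S : Fin N → ℕ) : netInput (a, S) ^ 2
      = (a : ℝ) ^ 2 + (-2 * a) * ∑ n, (S n : ℝ) + (∑ n, (S n : ℝ)) ^ 2 := by
    unfold netInput
    ring
  have h' (a : ℕ) : expect (serviceLaw service) (fun S => netInput (a, S) ^ 2)
      = (a : ℝ) ^ 2 + (-2 * ∑ n, expect (service n) fun k => (k : ℝ)) * a
        + expect (serviceLaw service) fun S => (∑ n, (S n : ℝ)) ^ 2 := by
    simp only [h]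
    rw [expect_add (hasFiniteMean_of_finite hfS _) (hasFiniteMean_of_finite hfS _),
      expect_add (hasFiniteMean_of_finite hfS _) (hasFiniteMean_of_finite hfS _),
      expect_const, expect_const_mul, expect_sum_serviceLaw hS]
    ring
  simp only [h']
  rw [expect_add (hasFiniteMean_of_finite hfA _) (hasFiniteMean_of_finite hfA _),
    expect_add (hasFiniteMean_of_finite hfA _) (hasFiniteMean_of_finite hfA _),
    expect_const, expect_const_mul]
  ring

lemma abs_netInput_le (hA : ∀ a ∈ arrival.support, a ≤ Amax)
    (hS : ∀ n, ∀ k ∈ (service n).support, k ≤ Smax) {p : ℕ × (Fin N → ℕ)}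
    (hp : p ∈ (noiseLaw arrival service).support) : |netInput p| ≤ Amax + N * Smax := by
  obtain ⟨h1, h2⟩ := mem_support_noiseLaw hp
  have h3 : (p.1 : ℝ) ≤ Amax := by exact_mod_cast hA _ h1
  have h4 : ∑ n, (p.2 n : ℝ) ≤ ∑ n : Fin N, (Smax : ℝ) := Finset.sum_le_sum fun n _ => by
    exact_mod_cast hS n _ (mem_support_of_mem_support_serviceLaw h2 n)
  simp only [Finset.sum_const, Finset.card_univ, Fintype.card_fin, nsmul_eq_mul] at h4
  have h5 : 0 ≤ ∑ n, (p.2 n : ℝ) := Finset.sum_nonneg fun n _ => Nat.cast_nonneg _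
  have h6 : (0 : ℝ) ≤ p.1 := Nat.cast_nonneg _
  unfold netInput
  rw [abs_le]
  constructor <;> linarith

end Noise

/-! ### The resource-pooled single-server queue. -/

section Pooled

variable {N : ℕ} {arrival : PMF ℕ} {service : Fin N → PMF ℕ} {Amax Smax : ℕ} {ε : ℝ}

/-- The Lindley recursion of the resource-pooled queue. -/
def pooledNext (q : ℕ) (p : ℕ × (Fin N → ℕ)) : ℕ := q + p.1 - ∑ n, p.2 n

lemma pooledStep_eq (q : ℕ) :
    pooledStep arrival service q = (noiseLaw arrival service).map (pooledNext q) := by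
  simp only [pooledStep, noiseLaw, PMF.map_bind, PMF.map_comp]
  rfl

lemma pooledNext_cast (q : ℕ) (p : ℕ × (Fin N → ℕ)) :
    (pooledNext q p : ℝ) = max (q + netInput p) 0 := by
  unfold pooledNext netInput
  rcases le_total (∑ n, p.2 n) (q + p.1) with h | h
  · rw [Nat.cast_sub h, max_eq_left]
    · push_cast; ring
    · have : ((∑ n, p.2 n : ℕ) : ℝ) ≤ ((q + p.1 : ℕ) : ℝ) := by exact_mod_cast h
      push_cast at this
      linarith
  · rw [Nat.sub_eq_zero_of_le h, max_eq_right]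
    · simp
    · have : ((q + p.1 : ℕ) : ℝ) ≤ ((∑ n, p.2 n : ℕ) : ℝ) := by exact_mod_cast h
      push_cast at this
      linarith

lemma pooled_drift (hA : ∀ a ∈ arrival.support, a ≤ Amax)
    (hS : ∀ n, ∀ k ∈ (service n).support, k ≤ Smax)
    (hmean : expect (noiseLaw arrival service) netInput = -ε) (q : ℕ) :
    expect (iterStep (pooledStep arrival service) 1 q) (fun k => (k : ℝ) ^ 2)
      ≤ (q : ℝ) ^ 2 - 2 * ε * q + expect (noiseLaw arrival service) fun p => netInput p ^ 2 := by
  have hf := finite_support_noiseLaw hA hS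
  have h1 : iterStep (pooledStep arrival service) 1 q = pooledStep arrival service q :=
    PMF.bind_pure _
  rw [h1, pooledStep_eq, expect_map]
  calc _ ≤ expect (noiseLaw arrival service) fun p =>
          (q : ℝ) ^ 2 + 2 * q * netInput p + netInput p ^ 2 := by
        refine expect_mono (hasFiniteMean_of_finite hf _) (hasFiniteMean_of_finite hf _)
          fun p _ => ?_
        rw [pooledNext_cast]
        rcases max_cases ((q : ℝ) + netInput p) 0 with h | h <;> rw [h.1] <;>
          nlinarith [sq_nonneg ((q : ℝ) + netInput p)]
    _ = _ := by
        rw [expect_add (hasFiniteMean_of_finite hf _) (hasFiniteMean_of_finite hf _),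
          expect_add (hasFiniteMean_of_finite hf _) (hasFiniteMean_of_finite hf _),
          expect_const, expect_const_mul, hmean]
        ring

lemma pooled_increment (hA : ∀ a ∈ arrival.support, a ≤ Amax)
    (hS : ∀ n, ∀ k ∈ (service n).support, k ≤ Smax) (q : ℕ) {q' : ℕ}
    (hq' : q' ∈ (pooledStep arrival service q).support) :
    |(q' : ℝ) - q| ≤ Amax + N * Smax := by
  rw [pooledStep_eq, PMF.support_map] at hq'
  obtain ⟨p, hp, rfl⟩ := hq'
  refine le_trans ?_ (abs_netInput_le hA hS hp)
  have h0 : (0 : ℝ) ≤ q := Nat.cast_nonneg q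
  rw [pooledNext_cast]
  rcases max_cases ((q : ℝ) + netInput p) 0 with h | h
  · rw [h.1, add_sub_cancel_left]
  · rw [h.1, zero_sub, abs_neg, abs_of_nonneg h0, abs_of_nonpos] <;> linarith

theorem exists_pooledStationary (hA : ∀ a ∈ arrival.support, a ≤ Amax)
    (hS : ∀ n, ∀ k ∈ (service n).support, k ≤ Smax) (hε : 0 < ε)
    (hmean : expect (noiseLaw arrival service) netInput = -ε) :
    ∃ ρ, IsPooledStationary arrival service ρ := by
  obtain ⟨ρ, -, hρ⟩ := exists_stationary_of_drift (P := pooledStep arrival service)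
    (S := Set.univ) (V := fun q : ℕ => (q : ℝ)) one_pos (fun _ _ _ _ => trivial)
    Set.univ_nonempty hε (by positivity) (fun q => Nat.cast_nonneg q)
    (fun q _ _ hq' => pooled_increment hA hS q hq') (fun q _ => pooled_drift hA hS hmean q)
    fun R => (Set.finite_Iic ⌊R⌋₊).subset fun q hq => Nat.le_floor hq
  exact ⟨ρ, hρ⟩

lemma pooled_second_moment (hA : ∀ a ∈ arrival.support, a ≤ Amax)
    (hS : ∀ n, ∀ k ∈ (service n).support, k ≤ Smax) (hε : 0 < ε)
    (hmean : expect (noiseLaw arrival service) netInput = -ε) {ρ : PMF ℕ}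
    (hρ : IsPooledStationary arrival service ρ) : HasFiniteMean ρ fun q => (q : ℝ) ^ 2 :=
  (second_moment_of_drift (P := pooledStep arrival service)
    (S := Set.univ) (V := fun q : ℕ => (q : ℝ)) one_pos (fun _ _ _ _ => trivial) hε
    (by positivity) (fun q => Nat.cast_nonneg q) (fun q _ _ hq' => pooled_increment hA hS q hq')
    (fun q _ => pooled_drift hA hS hmean q) (Set.subset_univ _) hρ).1

theorem pooled_bounds (hA : ∀ a ∈ arrival.support, a ≤ Amax)
    (hS : ∀ n, ∀ k ∈ (service n).support, k ≤ Smax) (hε : 0 < ε)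
    (hmean : expect (noiseLaw arrival service) netInput = -ε) {ρ : PMF ℕ}
    (hρ : IsPooledStationary arrival service ρ) {v : ℝ}
    (hv : expect (noiseLaw arrival service) (fun p => netInput p ^ 2) = v) :
    v - (Amax + N * Smax) * ε ≤ 2 * (ε * expect ρ fun q => (q : ℝ)) ∧
      2 * (ε * expect ρ fun q => (q : ℝ))
        ≤ v + Real.sqrt ε * (2 * 0 + (Amax + N * Smax) / 2) := by
  refine heavy_traffic_bounds (κ := fun _ => noiseLaw arrival service) (next := pooledNext)
    -- Here `w = 0` works: service is wasted only if the queue ends the slot empty.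
    (x := fun q : ℕ => (q : ℝ)) (w := fun _ => 0) (d := netInput)
    (u := fun q p => pooledNext q p - q - netInput p) ?_ (fun q => Nat.cast_nonneg q)
    (pooled_second_moment hA hS hε hmean hρ) hε (fun _ _ hp => abs_netInput_le hA hS hp)
    (fun q p _ => by ring) (fun q p _ => ?_) (fun q p hp => ?_) (fun _ => hmean) (fun _ => hv)
    (hasFiniteMean_of_bounded 0 (by simp)) (by simp [expect_const]) (fun q p hp => ?_)
  · simp only [← pooledStep_eq]
    exact hρ
  · rw [pooledNext_cast]
    linarith [le_max_left ((q : ℝ) + netInput p) 0]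
  · have h0 : (0 : ℝ) ≤ q := Nat.cast_nonneg q
    have := (abs_le.1 (abs_netInput_le hA hS hp)).1
    rw [pooledNext_cast]
    rcases max_cases ((q : ℝ) + netInput p) 0 with h | h <;> rw [h.1] <;>
      linarith [abs_netInput_le hA hS hp, abs_nonneg (netInput p)]
  · rw [pooledNext_cast, zero_mul]
    rcases max_cases ((q : ℝ) + netInput p) 0 with h | h <;> rw [h.1] <;> simp

end Pooled

/-! ### Geometry of the perpendicular component. -/

section Projection

variable {E : Type*} [NormedAddCommGroup E] [InnerProductSpace ℝ E]

/-- The component of `v` that is perpendicular to the unit vector `c`. -/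
def perpTo (c v : E) : E := v - (inner ℝ v c) • c

lemma perpTo_sub (c v w : E) : perpTo c (v - w) = perpTo c v - perpTo c w := by
  simp only [perpTo, inner_sub_left, sub_smul]
  abel

lemma perpTo_add (c v w : E) : perpTo c (v + w) = perpTo c v + perpTo c w := by
  simp only [perpTo, inner_add_left, add_smul]
  abel

lemma inner_perpTo_perpTo {c : E} (hc : ‖c‖ = 1) (v w : E) :
    inner ℝ (perpTo c v) (perpTo c w) = inner ℝ v w - inner ℝ v c * inner ℝ w c := by
  simp only [perpTo, inner_sub_left, inner_sub_right, inner_smul_left, inner_smul_right,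
    real_inner_self_eq_norm_sq, hc, real_inner_comm c w, RCLike.conj_to_real]
  ring

lemma inner_perpTo_left (c v w : E) :
    inner ℝ (perpTo c v) w = inner ℝ v w - inner ℝ v c * inner ℝ w c := by
  simp only [perpTo, inner_sub_left, inner_smul_left, real_inner_comm c w, RCLike.conj_to_real]

lemma norm_perpTo_sq {c : E} (hc : ‖c‖ = 1) (v : E) :
    ‖perpTo c v‖ ^ 2 = ‖v‖ ^ 2 - inner ℝ v c ^ 2 := by
  rw [← real_inner_self_eq_norm_sq, inner_perpTo_perpTo hc, real_inner_self_eq_norm_sq]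
  ring

lemma norm_perpTo_le {c : E} (hc : ‖c‖ = 1) (v : E) : ‖perpTo c v‖ ≤ ‖v‖ := by
  refine le_of_sq_le_sq ?_ (norm_nonneg v)
  rw [norm_perpTo_sq hc]
  nlinarith [sq_nonneg (inner ℝ v c : ℝ)]

/-- Pythagoras: `v + a` is `v'` minus a vector orthogonal to `v'`, so it is at least as long as
`v'`. That vector is the unused service in the application. -/
lemma norm_sq_le_of_inner_sub_eq_zero {v a v' : E} (h : inner ℝ v' (v' - (v + a)) = 0) :
    ‖v'‖ ^ 2 ≤ ‖v‖ ^ 2 + 2 * inner ℝ v a + ‖a‖ ^ 2 := by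
  rw [← norm_add_sq_real]
  have h1 := norm_sub_sq_real v' (v' - (v + a))
  rw [sub_sub_cancel, h] at h1
  nlinarith [sq_nonneg ‖v' - (v + a)‖]

/-- With `u = v' - (v + a)`, orthogonality of `v'` and `u` makes the inner product of their
perpendicular parts equal to `-⟨v', c⟩ ⟨u, c⟩ ≤ 0`. Removing `u` therefore cannot shorten the
perpendicular part of `v'`. -/
lemma norm_perpTo_sq_le {c v a v' : E} (hc : ‖c‖ = 1) (h : inner ℝ v' (v' - (v + a)) = 0)
    (h' : 0 ≤ (inner ℝ v' c : ℝ) * inner ℝ (v' - (v + a)) c) :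
    ‖perpTo c v'‖ ^ 2 ≤ ‖perpTo c v‖ ^ 2 + 2 * inner ℝ (perpTo c v) a + ‖a‖ ^ 2 := by
  have h1 := norm_sub_sq_real (perpTo c v') (perpTo c (v' - (v + a)))
  rw [← perpTo_sub, sub_sub_cancel, inner_perpTo_perpTo hc, h, perpTo_add, norm_add_sq_real,
    inner_perpTo_perpTo hc, ← inner_perpTo_left] at h1
  have h2 := norm_perpTo_le hc a
  have h3 : ‖perpTo c a‖ ^ 2 ≤ ‖a‖ ^ 2 := pow_le_pow_left₀ (norm_nonneg _) h2 2
  nlinarith [sq_nonneg ‖perpTo c (v' - (v + a))‖]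

end Projection

/-! ### Unused service and the change of the queues in one slot. -/

section Dynamics

variable {N : ℕ}

/-- The service that queue `n` does not use in the slot. -/
def unused (Z : State N) (ω : Slot N) (n : Fin N) : ℝ :=
  ((Z.next ω).queue n : ℝ) - (Z.queue n + (ω.routed n - ω.service n))

lemma next_queue_cast (Z : State N) (ω : Slot N) (n : Fin N) :
    ((Z.next ω).queue n : ℝ)
      = max ((Z.queue n : ℝ) + ((ω.routed n : ℝ) - (ω.service n : ℝ))) 0 := by
  simp only [State.next]
  rcases le_total (ω.service n) (Z.queue n + ω.routed n) with h | h
  · rw [Nat.cast_sub h, max_eq_left]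
    · push_cast; ring
    · have : (ω.service n : ℝ) ≤ ((Z.queue n + ω.routed n : ℕ) : ℝ) := by exact_mod_cast h
      push_cast at this
      linarith
  · rw [Nat.sub_eq_zero_of_le h, max_eq_right]
    · simp
    · have : ((Z.queue n + ω.routed n : ℕ) : ℝ) ≤ (ω.service n : ℝ) := by exact_mod_cast h
      push_cast at this
      linarith

lemma unused_nonneg (Z : State N) (ω : Slot N) (n : Fin N) : 0 ≤ unused Z ω n := by
  rw [unused, next_queue_cast, sub_nonneg]
  exact le_max_left _ _

lemma unused_le (Z : State N) (ω : Slot N) (n : Fin N) : unused Z ω n ≤ ω.service n := by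
  have h1 : (0 : ℝ) ≤ Z.queue n := Nat.cast_nonneg _
  have h2 : (0 : ℝ) ≤ ω.routed n := Nat.cast_nonneg _
  have h3 : (0 : ℝ) ≤ ω.service n := Nat.cast_nonneg _
  rw [unused, next_queue_cast, sub_le_iff_le_add]
  exact max_le (by linarith) (by linarith)

lemma next_queue_mul_unused (Z : State N) (ω : Slot N) (n : Fin N) :
    ((Z.next ω).queue n : ℝ) * unused Z ω n = 0 := by
  rw [unused, next_queue_cast]
  rcases max_cases ((Z.queue n : ℝ) + ((ω.routed n : ℝ) - (ω.service n : ℝ))) 0 with h | h <;>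
    rw [h.1] <;> simp

lemma vec_next_sub_apply (Z : State N) (ω : Slot N) (n : Fin N) :
    ((Z.next ω).vec - (Z.vec + ω.netVec)) n = unused Z ω n := rfl

lemma inner_vec_next_unused (Z : State N) (ω : Slot N) :
    inner ℝ (Z.next ω).vec ((Z.next ω).vec - (Z.vec + ω.netVec)) = 0 := by
  rw [PiLp.inner_apply]
  refine Finset.sum_eq_zero fun n _ => ?_
  rw [vec_next_sub_apply, RCLike.inner_apply, RCLike.conj_to_real, mul_comm]
  exact next_queue_mul_unused Z ω n

lemma norm_unitDiag (hN : 0 < N) : ‖unitDiag N‖ = 1 := by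
  have hN' : (0 : ℝ) < N := by exact_mod_cast hN
  rw [← sq_eq_sq₀ (norm_nonneg _) zero_le_one, EuclideanSpace.norm_sq_eq]
  simp only [unitDiag, Real.norm_eq_abs, sq_abs, div_pow, one_pow, Real.sq_sqrt hN'.le,
    Finset.sum_const, Finset.card_univ, Fintype.card_fin, nsmul_eq_mul]
  field_simp

lemma inner_unitDiag (v : EuclideanSpace ℝ (Fin N)) :
    inner ℝ v (unitDiag N) = (∑ n, v n) / Real.sqrt N := by
  rw [PiLp.inner_apply, Finset.sum_div]
  refine Finset.sum_congr rfl fun n _ => ?_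
  simp [unitDiag, div_eq_inv_mul]

lemma perp_eq (Z : State N) : Z.perp = perpTo (unitDiag N) Z.vec := rfl

lemma norm_le_of_forall_abs_le {v : EuclideanSpace ℝ (Fin N)} {b : ℝ} (h : ∀ n, |v n| ≤ b) :
    ‖v‖ ≤ Real.sqrt (N * b ^ 2) := by
  refine Real.le_sqrt_of_sq_le ?_
  rw [EuclideanSpace.norm_sq_eq]
  calc _ ≤ ∑ _n : Fin N, b ^ 2 := Finset.sum_le_sum fun n _ =>
        pow_le_pow_left₀ (norm_nonneg _) (h n) 2
    _ = _ := by simp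

lemma vec_next_sq_le (Z : State N) (ω : Slot N) :
    ‖(Z.next ω).vec‖ ^ 2 ≤ ‖Z.vec‖ ^ 2 + 2 * inner ℝ Z.vec ω.netVec + ‖ω.netVec‖ ^ 2 :=
  norm_sq_le_of_inner_sub_eq_zero (inner_vec_next_unused Z ω)

lemma perp_next_sq_le (hN : 0 < N) (Z : State N) (ω : Slot N) :
    ‖(Z.next ω).perp‖ ^ 2 ≤ ‖Z.perp‖ ^ 2 + 2 * inner ℝ Z.perp ω.netVec + ‖ω.netVec‖ ^ 2 := by
  refine norm_perpTo_sq_le (norm_unitDiag hN) (inner_vec_next_unused Z ω) ?_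
  rw [inner_unitDiag, inner_unitDiag]
  refine mul_nonneg (div_nonneg (Finset.sum_nonneg fun n _ => ?_) (Real.sqrt_nonneg _))
    (div_nonneg (Finset.sum_nonneg fun n _ => ?_) (Real.sqrt_nonneg _))
  · exact Nat.cast_nonneg _
  · rw [vec_next_sub_apply]
    exact unused_nonneg Z ω n

lemma perp_apply (Z : State N) (n : Fin N) :
    N * Z.perp n = N * Z.queue n - ∑ k, (Z.queue k : ℝ) := by
  have hN : (0 : ℝ) < N := by exact_mod_cast n.pos
  have h : Z.perp n = Z.queue n - (∑ k, (Z.queue k : ℝ)) / Real.sqrt N * (1 / Real.sqrt N) := by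
    have := inner_unitDiag Z.vec
    simp only [State.perp, this]
    rfl
  have hs : Real.sqrt N * Real.sqrt N = N := Real.mul_self_sqrt hN.le
  rw [h, div_mul_div_comm, hs, mul_one, mul_sub, mul_div_cancel₀ _ hN.ne']

lemma total_next (Z : State N) (ω : Slot N) :
    ∑ n, ((Z.next ω).queue n : ℝ)
      = ∑ n, (Z.queue n : ℝ) + netInput (ω.arrivals, ω.service) + ∑ n, unused Z ω n := by
  have h : ∑ n, (ω.routed n : ℝ) = ω.arrivals := by
    simp [Slot.routed]
  simp only [unused, netInput, Finset.sum_sub_distrib, Finset.sum_add_distrib, h]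
  ring

/-- Where server `n` has unused service, its queue ends empty. The total is then exactly `-N` times
the `n`-th coordinate of the perpendicular component, hence at most `N` times its norm. -/
lemma total_next_mul_unused_le (Z : State N) (ω : Slot N) :
    (∑ n, ((Z.next ω).queue n : ℝ)) * ∑ n, unused Z ω n
      ≤ N * ‖(Z.next ω).perp‖ * ∑ n, unused Z ω n := by
  rw [Finset.mul_sum, Finset.mul_sum]
  refine Finset.sum_le_sum fun n _ => ?_
  have h0 := next_queue_mul_unused Z ω n
  have h1 := perp_apply (Z.next ω) n
  have h2 : -(Z.next ω).perp n ≤ ‖(Z.next ω).perp‖ :=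
    (neg_le_abs _).trans (PiLp.norm_apply_le (Z.next ω).perp n)
  have h3 : (∑ k, ((Z.next ω).queue k : ℝ)) * unused Z ω n
      = N * -(Z.next ω).perp n * unused Z ω n := by
    have : (∑ k, ((Z.next ω).queue k : ℝ))
        = N * -(Z.next ω).perp n + N * (Z.next ω).queue n := by linarith
    rw [this, add_mul, mul_assoc (N : ℝ) ((Z.next ω).queue n : ℝ), h0]
    ring
  rw [h3]
  exact mul_le_mul_of_nonneg_right (mul_le_mul_of_nonneg_left h2 (Nat.cast_nonneg N))
    (unused_nonneg Z ω n)

lemma total_sq_le (Z : State N) : (∑ n, (Z.queue n : ℝ)) ^ 2 ≤ N * ‖Z.vec‖ ^ 2 := by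
  have h := sq_sum_le_card_mul_sum_sq (s := Finset.univ) (f := fun n => (Z.queue n : ℝ))
  rw [EuclideanSpace.norm_sq_eq]
  simpa [State.vec] using h

lemma finite_norm_vec_le (R : ℝ) : {Z : State N | ‖Z.vec‖ ≤ R}.Finite := by
  have hf : ((Set.Icc (0 : Fin N → ℕ) fun _ => ⌊R⌋₊) ×ˢ
      (Set.univ : Set (Finset (Fin N)))).Finite := (Set.finite_Icc _ _).prod Set.finite_univ
  refine (hf.image fun p => (⟨p.1, p.2⟩ : State N)).subset fun Z hZ =>
    ⟨(Z.queue, Z.memory), ⟨⟨fun n => Nat.zero_le _, fun n => Nat.le_floor ?_⟩, trivial⟩, rfl⟩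
  have h := PiLp.norm_apply_le Z.vec n
  rw [Real.norm_of_nonneg (by exact Nat.cast_nonneg _)] at h
  exact h.trans hZ

end Dynamics

/-! ### The load balancing system: drift, moments and bounds. -/

section System

variable {N : ℕ} {sys : System N} {Amax Smax : ℕ}

/-- The destination and the new memory integrate out. Hence the net input has the same law in every
state, whatever the policy. -/
lemma map_slotLaw (Z : State N) :
    (sys.slotLaw Z).map (fun ω => (ω.arrivals, ω.service))
      = noiseLaw sys.arrival sys.service := by
  simp only [System.slotLaw, noiseLaw, PMF.map_bind, PMF.map_comp]
  congr 1
  funext a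
  rw [← PMF.bind_pure_comp]
  congr 1
  funext S
  simp only [Function.comp_def]
  have h (p : PMF (Finset (Fin N))) : p.map (fun _ => (a, S)) = PMF.pure (a, S) :=
    PMF.map_const p _
  simp only [h]
  exact PMF.bind_const _ _

lemma finite_support_slotLaw (hA : ∀ a ∈ sys.arrival.support, a ≤ Amax)
    (hS : ∀ n, ∀ k ∈ (sys.service n).support, k ≤ Smax) (Z : State N) :
    (sys.slotLaw Z).support.Finite :=
  finite_support_bind (finite_support_nat hA) fun _ =>
    finite_support_bind (finite_support_serviceLaw hS) fun _ =>
      finite_support_bind (Set.toFinite _) fun _ => finite_support_map _ (Set.toFinite _)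

lemma mem_support_noiseLaw_of_slotLaw {Z : State N} {ω : Slot N}
    (hω : ω ∈ (sys.slotLaw Z).support) :
    (ω.arrivals, ω.service) ∈ (noiseLaw sys.arrival sys.service).support := by
  rw [← map_slotLaw Z, PMF.support_map]
  exact ⟨ω, hω, rfl⟩

lemma abs_netVec_apply_le (hA : ∀ a ∈ sys.arrival.support, a ≤ Amax)
    (hS : ∀ n, ∀ k ∈ (sys.service n).support, k ≤ Smax) {Z : State N} {ω : Slot N}
    (hω : ω ∈ (sys.slotLaw Z).support) (n : Fin N) : |ω.netVec n| ≤ (Amax : ℝ) + Smax := by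
  obtain ⟨h1, h2⟩ := mem_support_noiseLaw (mem_support_noiseLaw_of_slotLaw hω)
  have h3 : (ω.service n : ℝ) ≤ Smax := by
    exact_mod_cast hS n _ (mem_support_of_mem_support_serviceLaw h2 n)
  have h4 : (ω.routed n : ℝ) ≤ Amax := by
    have : ω.routed n ≤ ω.arrivals := by
      unfold Slot.routed
      split_ifs <;> simp
    exact_mod_cast this.trans (hA _ h1)
  have h5 : (0 : ℝ) ≤ ω.service n := Nat.cast_nonneg _
  have h6 : (0 : ℝ) ≤ ω.routed n := Nat.cast_nonneg _
  change |(ω.routed n : ℝ) - ω.service n| ≤ _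
  rw [abs_le]
  constructor <;> linarith

/-- A bound on the Euclidean length of the changes in a slot. -/
def slotBound (N Amax Smax : ℕ) : ℝ := Real.sqrt (N * ((Amax : ℝ) + Smax) ^ 2)

lemma slotBound_nonneg (N Amax Smax : ℕ) : 0 ≤ slotBound N Amax Smax := Real.sqrt_nonneg _

lemma norm_netVec_le (hA : ∀ a ∈ sys.arrival.support, a ≤ Amax)
    (hS : ∀ n, ∀ k ∈ (sys.service n).support, k ≤ Smax) {Z : State N} {ω : Slot N}
    (hω : ω ∈ (sys.slotLaw Z).support) : ‖ω.netVec‖ ≤ slotBound N Amax Smax :=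
  norm_le_of_forall_abs_le (abs_netVec_apply_le hA hS hω)

lemma norm_vec_next_sub_le (hA : ∀ a ∈ sys.arrival.support, a ≤ Amax)
    (hS : ∀ n, ∀ k ∈ (sys.service n).support, k ≤ Smax) {Z : State N} {ω : Slot N}
    (hω : ω ∈ (sys.slotLaw Z).support) :
    ‖(Z.next ω).vec - Z.vec‖ ≤ slotBound N Amax Smax := by
  refine norm_le_of_forall_abs_le fun n => le_trans ?_ (abs_netVec_apply_le hA hS hω n)
  change |((Z.next ω).queue n : ℝ) - Z.queue n| ≤ |(ω.routed n : ℝ) - ω.service n|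
  have h0 : (0 : ℝ) ≤ Z.queue n := Nat.cast_nonneg _
  rw [next_queue_cast]
  rcases max_cases ((Z.queue n : ℝ) + ((ω.routed n : ℝ) - (ω.service n : ℝ))) 0 with h | h
  · rw [h.1, add_sub_cancel_left]
  · rw [h.1, zero_sub, abs_neg, abs_of_nonneg h0, abs_of_nonpos] <;> linarith

lemma abs_norm_perp_next_sub_le (hN : 0 < N) (hA : ∀ a ∈ sys.arrival.support, a ≤ Amax)
    (hS : ∀ n, ∀ k ∈ (sys.service n).support, k ≤ Smax) {Z : State N} {ω : Slot N}
    (hω : ω ∈ (sys.slotLaw Z).support) :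
    |‖(Z.next ω).perp‖ - ‖Z.perp‖| ≤ slotBound N Amax Smax := by
  refine (abs_norm_sub_norm_le _ _).trans ?_
  rw [perp_eq, perp_eq, ← perpTo_sub]
  exact (norm_perpTo_le (norm_unitDiag hN) _).trans (norm_vec_next_sub_le hA hS hω)

lemma finite_support_pathLaw (hfin : ∀ Z, (sys.slotLaw Z).support.Finite) (T : ℕ) (Z : State N) :
    (sys.pathLaw T Z).support.Finite := by
  induction T generalizing Z with
  | zero => simp [System.pathLaw, PMF.support_pure]
  | succ T ih => exact finite_support_bind (hfin Z) fun ω => finite_support_map _ (ih _)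

lemma condSum_zero (f : State N → Slot N → ℝ) (Z : State N) : sys.condSum 0 f Z = 0 := by
  simp [System.condSum, System.pathLaw, expect_pure]

lemma condSum_succ (hfin : ∀ Z, (sys.slotLaw Z).support.Finite) (T : ℕ)
    (f : State N → Slot N → ℝ) (Z : State N) :
    sys.condSum (T + 1) f Z
      = expect (sys.slotLaw Z) fun ω => f Z ω + sys.condSum T f (Z.next ω) := by
  have h := hasFiniteMean_of_finite (finite_support_pathLaw hfin (T + 1) Z)
    fun l => (l.map fun x => f x.1 x.2).sum
  unfold System.condSum
  rw [System.pathLaw] at h ⊢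
  rw [expect_bind h]
  refine expect_congr fun ω _ => ?_
  simp only [expect_map, List.map_cons, List.sum_cons]
  rw [expect_add (hasFiniteMean_const _ _)
    (hasFiniteMean_of_finite (finite_support_pathLaw hfin T _) _), expect_const]

lemma finite_support_iterStep (hfin : ∀ Z, (sys.slotLaw Z).support.Finite) (T : ℕ)
    (Z : State N) : (iterStep sys.step T Z).support.Finite := by
  induction T generalizing Z with
  | zero => simp [iterStep, PMF.support_pure]
  | succ T ih => exact finite_support_bind (finite_support_map _ (hfin Z)) fun _ => ih _

lemma expect_iterStep_succ (hfin : ∀ Z, (sys.slotLaw Z).support.Finite) (T : ℕ)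
    (g : State N → ℝ) (Z : State N) :
    expect (iterStep sys.step (T + 1) Z) g
      = expect (sys.slotLaw Z) fun ω => expect (iterStep sys.step T (Z.next ω)) g := by
  have h := hasFiniteMean_of_finite (finite_support_iterStep hfin (T + 1) Z) g
  rw [iterStep] at h ⊢
  rw [expect_bind h, System.step, expect_map]

/-- A bound on the change of `g` in each slot gives a bound on the mean change of `g` over several
slots. -/
lemma expect_iterStep_le (hfin : ∀ Z, (sys.slotLaw Z).support.Finite) {g : State N → ℝ}
    {f : State N → Slot N → ℝ} {B : ℝ}
    (h : ∀ Z, ∀ ω ∈ (sys.slotLaw Z).support, g (Z.next ω) ≤ g Z + 2 * f Z ω + B) (T : ℕ)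
    (Z : State N) :
    expect (iterStep sys.step T Z) g ≤ g Z + 2 * sys.condSum T f Z + T * B := by
  induction T generalizing Z with
  | zero => simp [iterStep, expect_pure, condSum_zero]
  | succ T ih =>
    rw [expect_iterStep_succ hfin, condSum_succ hfin]
    calc _ ≤ expect (sys.slotLaw Z) fun ω =>
            2 * (f Z ω + sys.condSum T f (Z.next ω)) + (g Z + (T + 1) * B) := by
          refine expect_mono (hasFiniteMean_of_finite (hfin Z) _)
            (hasFiniteMean_of_finite (hfin Z) _) fun ω hω => ?_
          linarith [ih (Z.next ω), h Z ω hω]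
      _ = _ := by
          rw [expect_add (hasFiniteMean_of_finite (hfin Z) _)
            (hasFiniteMean_of_finite (hfin Z) _), expect_const_mul, expect_const]
          push_cast
          ring

variable {𝒵 : Set (State N)}

lemma vec_drift (hA : ∀ a ∈ sys.arrival.support, a ≤ Amax)
    (hS : ∀ n, ∀ k ∈ (sys.service n).support, k ≤ Smax) {T : ℕ} {K γ : ℝ} {Z : State N}
    (h : sys.condSum T (fun Z' ω => inner ℝ Z'.vec ω.netVec) Z ≤ -γ * ‖Z.vec‖ + K) :
    expect (iterStep sys.step T Z) (fun Z' => ‖Z'.vec‖ ^ 2)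
      ≤ ‖Z.vec‖ ^ 2 - 2 * γ * ‖Z.vec‖ + (2 * K + T * slotBound N Amax Smax ^ 2) := by
  have := expect_iterStep_le (finite_support_slotLaw hA hS) (g := fun Z' => ‖Z'.vec‖ ^ 2)
    (f := fun Z' ω => inner ℝ Z'.vec ω.netVec) (B := slotBound N Amax Smax ^ 2)
    (fun Z ω hω => (vec_next_sq_le Z ω).trans (add_le_add le_rfl
      (pow_le_pow_left₀ (norm_nonneg _) (norm_netVec_le hA hS hω) 2))) T Z
  linarith

lemma perp_drift (hN : 0 < N) (hA : ∀ a ∈ sys.arrival.support, a ≤ Amax)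
    (hS : ∀ n, ∀ k ∈ (sys.service n).support, k ≤ Smax) {T : ℕ} {K η : ℝ} {Z : State N}
    (h : sys.condSum T (fun Z' ω => inner ℝ Z'.perp ω.netVec) Z ≤ -η * ‖Z.perp‖ + K) :
    expect (iterStep sys.step T Z) (fun Z' => ‖Z'.perp‖ ^ 2)
      ≤ ‖Z.perp‖ ^ 2 - 2 * η * ‖Z.perp‖ + (2 * K + T * slotBound N Amax Smax ^ 2) := by
  have := expect_iterStep_le (finite_support_slotLaw hA hS) (g := fun Z' => ‖Z'.perp‖ ^ 2)
    (f := fun Z' ω => inner ℝ Z'.perp ω.netVec) (B := slotBound N Amax Smax ^ 2)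
    (fun Z ω hω => (perp_next_sq_le hN Z ω).trans (add_le_add le_rfl
      (pow_le_pow_left₀ (norm_nonneg _) (norm_netVec_le hA hS hω) 2))) T Z
  linarith

lemma vec_increment (hA : ∀ a ∈ sys.arrival.support, a ≤ Amax)
    (hS : ∀ n, ∀ k ∈ (sys.service n).support, k ≤ Smax) {Z Z' : State N}
    (hZ' : Z' ∈ (sys.step Z).support) : |‖Z'.vec‖ - ‖Z.vec‖| ≤ slotBound N Amax Smax := by
  rw [System.step, PMF.support_map] at hZ'
  obtain ⟨ω, hω, rfl⟩ := hZ'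
  exact (abs_norm_sub_norm_le _ _).trans (norm_vec_next_sub_le hA hS hω)

lemma perp_increment (hN : 0 < N) (hA : ∀ a ∈ sys.arrival.support, a ≤ Amax)
    (hS : ∀ n, ∀ k ∈ (sys.service n).support, k ≤ Smax) {Z Z' : State N}
    (hZ' : Z' ∈ (sys.step Z).support) : |‖Z'.perp‖ - ‖Z.perp‖| ≤ slotBound N Amax Smax := by
  rw [System.step, PMF.support_map] at hZ'
  obtain ⟨ω, hω, rfl⟩ := hZ'
  exact abs_norm_perp_next_sub_le hN hA hS hω

theorem System.exists_isStationary (hA : ∀ a ∈ sys.arrival.support, a ≤ Amax)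
    (hS : ∀ n, ∀ k ∈ (sys.service n).support, k ≤ Smax) (h𝒵 : sys.IsStateSpace 𝒵)
    (h : sys.ThroughputCondition 𝒵) : ∃ ν, sys.IsStationary 𝒵 ν := by
  obtain ⟨T, K, γ, hT, -, hγ, hdrift⟩ := h
  exact exists_stationary_of_drift (V := fun Z : State N => ‖Z.vec‖) hT h𝒵.2 h𝒵.1 hγ
    (slotBound_nonneg N Amax Smax) (fun _ => norm_nonneg _)
    (fun _ _ _ hZ' => vec_increment hA hS hZ') (fun Z hZ => vec_drift hA hS (hdrift Z hZ))
    finite_norm_vec_le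

lemma System.total_second_moment (hA : ∀ a ∈ sys.arrival.support, a ≤ Amax)
    (hS : ∀ n, ∀ k ∈ (sys.service n).support, k ≤ Smax) (h𝒵 : sys.IsStateSpace 𝒵)
    (h : sys.ThroughputCondition 𝒵) {ν : PMF (State N)} (hν : sys.IsStationary 𝒵 ν) :
    HasFiniteMean ν fun Z => (∑ n, (Z.queue n : ℝ)) ^ 2 := by
  obtain ⟨T, K, γ, hT, -, hγ, hdrift⟩ := h
  have := (second_moment_of_drift (V := fun Z : State N => ‖Z.vec‖) hT h𝒵.2 hγ
    (slotBound_nonneg N Amax Smax) (fun _ => norm_nonneg _)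
    (fun _ _ _ hZ' => vec_increment hA hS hZ') (fun Z hZ => vec_drift hA hS (hdrift Z hZ))
    hν.1 hν.2).1
  refine (this.const_mul N).mono fun Z _ => ?_
  rw [abs_of_nonneg (sq_nonneg _)]
  exact total_sq_le Z

/-- State-space collapse: a bound on the second moment of the perpendicular component that does not
depend on the arrival law. -/
lemma System.perp_second_moment (hN : 0 < N) (hA : ∀ a ∈ sys.arrival.support, a ≤ Amax)
    (hS : ∀ n, ∀ k ∈ (sys.service n).support, k ≤ Smax) (h𝒵 : sys.IsStateSpace 𝒵) {T : ℕ}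
    {K η : ℝ} (hT : 0 < T) (hη : 0 < η) (h : sys.PerpCondition 𝒵 T K η) {ν : PMF (State N)}
    (hν : sys.IsStationary 𝒵 ν) :
    HasFiniteMean ν (fun Z => ‖Z.perp‖ ^ 2) ∧ expect ν (fun Z => ‖Z.perp‖ ^ 2)
      ≤ momentBound η (2 * K + T * slotBound N Amax Smax ^ 2) (T * slotBound N Amax Smax) / η :=
  second_moment_of_drift (V := fun Z : State N => ‖Z.perp‖) hT h𝒵.2 hη
    (slotBound_nonneg N Amax Smax) (fun _ => norm_nonneg _)
    (fun _ _ _ hZ' => perp_increment hN hA hS hZ') (fun Z hZ => perp_drift hN hA hS (h Z hZ))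
    hν.1 hν.2

/-- `heavy_traffic_bounds` with `w = N ‖Q_⊥‖`, which is where the factor `N ^ 2` in front of `C`
comes from. -/
theorem System.total_bounds (hA : ∀ a ∈ sys.arrival.support, a ≤ Amax)
    (hS : ∀ n, ∀ k ∈ (sys.service n).support, k ≤ Smax) {ε v C : ℝ} (hε : 0 < ε)
    (hmean : expect (noiseLaw sys.arrival sys.service) netInput = -ε)
    (hv : expect (noiseLaw sys.arrival sys.service) (fun p => netInput p ^ 2) = v)
    {ν : PMF (State N)} (hν : ν.bind sys.step = ν)
    (h2 : HasFiniteMean ν fun Z => (∑ n, (Z.queue n : ℝ)) ^ 2)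
    (hp : HasFiniteMean ν fun Z => ‖Z.perp‖ ^ 2) (hC : expect ν (fun Z => ‖Z.perp‖ ^ 2) ≤ C) :
    v - (Amax + N * Smax) * ε ≤ 2 * (ε * expect ν fun Z => ∑ n, (Z.queue n : ℝ)) ∧
      2 * (ε * expect ν fun Z => ∑ n, (Z.queue n : ℝ))
        ≤ v + Real.sqrt ε * (2 * (N ^ 2 * C) + (Amax + N * Smax) / 2) := by
  have hE (f : ℕ × (Fin N → ℕ) → ℝ) (Z : State N) :
      expect (sys.slotLaw Z) (fun ω => f (ω.arrivals, ω.service))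
        = expect (noiseLaw sys.arrival sys.service) f := by
    rw [← expect_map (sys.slotLaw Z) (fun ω => (ω.arrivals, ω.service)) f, map_slotLaw]
  refine heavy_traffic_bounds (κ := sys.slotLaw) (next := State.next)
    (w := fun Z => N * ‖Z.perp‖) (d := fun ω => netInput (ω.arrivals, ω.service))
    (u := fun Z ω => ∑ n, unused Z ω n) hν
    (fun Z => Finset.sum_nonneg fun n _ => Nat.cast_nonneg _) h2 hε
    (fun Z ω hω => abs_netInput_le hA hS (mem_support_noiseLaw_of_slotLaw hω))
    (fun Z ω _ => total_next Z ω) (fun Z ω _ => Finset.sum_nonneg fun n _ => unused_nonneg Z ω n)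
    (fun Z ω hω => ?_) (fun Z => (hE netInput Z).trans hmean)
    (fun Z => (hE (fun p => netInput p ^ 2) Z).trans hv) ?_ ?_
    (fun Z ω _ => total_next_mul_unused_le Z ω)
  · calc ∑ n, unused Z ω n ≤ ∑ _n : Fin N, (Smax : ℝ) := by
          refine Finset.sum_le_sum fun n _ => (unused_le Z ω n).trans ?_
          exact_mod_cast hS n _ (mem_support_of_mem_support_serviceLaw
            (mem_support_noiseLaw (mem_support_noiseLaw_of_slotLaw hω)).2 n)
      _ ≤ _ := by simp
  · simp only [mul_pow]
    exact hp.const_mul _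
  · simp only [mul_pow]
    rw [expect_const_mul]
    gcongr

end System

/-! ### Passage to the heavy-traffic limit. -/

open Filter Topology in
lemma tendsto_of_heavy_traffic_bounds {x v : ℝ → ℝ} {V b c δ : ℝ} (hδ : 0 < δ)
    (hv : Tendsto v (𝓝[>] 0) (𝓝 V))
    (h : ∀ ε ∈ Set.Ioo 0 δ, v ε - b * ε ≤ 2 * x ε ∧ 2 * x ε ≤ v ε + Real.sqrt ε * c) :
    Tendsto x (𝓝[>] 0) (𝓝 (V / 2)) := by
  have hid : Tendsto (fun ε : ℝ => ε) (𝓝[>] 0) (𝓝 0) := tendsto_id.mono_left nhdsWithin_le_nhds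
  have hsqrt : Tendsto (fun ε : ℝ => Real.sqrt ε) (𝓝[>] 0) (𝓝 0) := by
    simpa using hid.sqrt
  have h1 : Tendsto (fun ε => v ε - b * ε) (𝓝[>] 0) (𝓝 V) := by
    simpa using hv.sub (hid.const_mul b)
  have h2 : Tendsto (fun ε => v ε + Real.sqrt ε * c) (𝓝[>] 0) (𝓝 V) := by
    simpa using hv.add (hsqrt.mul_const c)
  have hev : ∀ᶠ ε in 𝓝[>] (0 : ℝ), ε ∈ Set.Ioo 0 δ := Ioo_mem_nhdsGT hδ
  have h3 : Tendsto (fun ε => 2 * x ε) (𝓝[>] 0) (𝓝 V) :=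
    tendsto_of_tendsto_of_tendsto_of_le_of_le' h1 h2 (hev.mono fun ε hε => (h ε hε).1)
      (hev.mono fun ε hε => (h ε hε).2)
  refine (h3.div_const 2).congr fun ε => ?_
  ring

end

end LoadBalancing

theorem lemma2 {N : ℕ}
    -- the policy, the laws of the offered services, and the arrival laws indexed by `ε`
    (policy : LoadBalancing.Policy N) (service : Fin N → PMF ℕ) (arrival : ℝ → PMF ℕ)
    -- the total service rate, the bounds, and the limit of the variances of the arrivals
    (μtot : ℝ) (Smax Amax : ℕ) (σsq : ℝ)
    (hμ : μtot = ∑ n, LoadBalancing.expect (service n) (fun k => (k : ℝ))) (hμ_pos : 0 < μtot)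
    (hSmax : ∀ n, ∀ k ∈ (service n).support, k ≤ Smax)
    (hAmax : ∀ ε ∈ Set.Ioo 0 μtot, ∀ a ∈ (arrival ε).support, a ≤ Amax)
    (hmean : ∀ ε ∈ Set.Ioo 0 μtot,
      LoadBalancing.expect (arrival ε) (fun a => (a : ℝ)) = μtot - ε)
    (hvar : Filter.Tendsto (fun ε => LoadBalancing.natVariance (arrival ε))
      (nhdsWithin 0 (Set.Ioi 0)) (nhds σsq))
    -- the state space
    (𝒵 : Set (LoadBalancing.State N))
    (h𝒵 : ∀ ε ∈ Set.Ioo 0 μtot,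
      (LoadBalancing.System.mk (arrival ε) service policy).IsStateSpace 𝒵)
    -- the first drift condition, for every arrival rate below the total service rate
    (hthroughput : ∀ ε ∈ Set.Ioo 0 μtot,
      (LoadBalancing.System.mk (arrival ε) service policy).ThroughputCondition 𝒵)
    -- the second drift condition, with constants that do not depend on `ε`
    (T₂ : ℕ) (K₂ η ε₀ : ℝ) (hT₂ : 0 < T₂) (hK₂ : 0 ≤ K₂) (hη : 0 < η) (hε₀ : 0 < ε₀)
    (hperp : ∀ ε ∈ Set.Ioo 0 μtot, ε < ε₀ →
      (LoadBalancing.System.mk (arrival ε) service policy).PerpCondition 𝒵 T₂ K₂ η) :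
    -- stationary distributions exist, with finite mean queue lengths
    (∀ ε ∈ Set.Ioo 0 μtot,
      (∃ ν, (LoadBalancing.System.mk (arrival ε) service policy).IsStationary 𝒵 ν) ∧
      (∀ ν, (LoadBalancing.System.mk (arrival ε) service policy).IsStationary 𝒵 ν →
        LoadBalancing.HasFiniteMean ν (fun Z => ∑ n, (Z.queue n : ℝ))) ∧
      (∃ ρ, LoadBalancing.IsPooledStationary (arrival ε) service ρ) ∧
      (∀ ρ, LoadBalancing.IsPooledStationary (arrival ε) service ρ →
        LoadBalancing.HasFiniteMean ρ (fun q => (q : ℝ)))) ∧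
    -- the two heavy-traffic limits exist and are equal
    ∃ L : ℝ, ∀ (ν : ℝ → PMF (LoadBalancing.State N)) (ρ : ℝ → PMF ℕ),
      (∀ ε ∈ Set.Ioo 0 μtot,
        (LoadBalancing.System.mk (arrival ε) service policy).IsStationary 𝒵 (ν ε)) →
      (∀ ε ∈ Set.Ioo 0 μtot, LoadBalancing.IsPooledStationary (arrival ε) service (ρ ε)) →
      Filter.Tendsto
        (fun ε => ε * LoadBalancing.expect (ν ε) (fun Z => ∑ n, (Z.queue n : ℝ)))
        (nhdsWithin 0 (Set.Ioi 0)) (nhds L) ∧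
      Filter.Tendsto (fun ε => ε * LoadBalancing.expect (ρ ε) (fun q => (q : ℝ)))
        (nhdsWithin 0 (Set.Ioi 0)) (nhds L) := by
  -- Without servers the total service rate would be zero.
  have hN : 0 < N := by
    rcases Nat.eq_zero_or_pos N with rfl | h
    · simp [hμ] at hμ_pos
    · exact h
  have hnet : ∀ ε ∈ Set.Ioo 0 μtot, LoadBalancing.expect
      (LoadBalancing.noiseLaw (arrival ε) service) LoadBalancing.netInput = -ε := fun ε hε => by
    rw [LoadBalancing.expect_netInput (hAmax ε hε) hSmax, hmean ε hε, ← hμ]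
    ring
  refine ⟨fun ε hε => ⟨LoadBalancing.System.exists_isStationary (hAmax ε hε) hSmax (h𝒵 ε hε)
      (hthroughput ε hε), fun ν hν => LoadBalancing.hasFiniteMean_of_sq
      (LoadBalancing.System.total_second_moment (hAmax ε hε) hSmax (h𝒵 ε hε)
        (hthroughput ε hε) hν),
    LoadBalancing.exists_pooledStationary (hAmax ε hε) hSmax hε.1 (hnet ε hε),
    fun ρ hρ => LoadBalancing.hasFiniteMean_of_sq
      (LoadBalancing.pooled_second_moment (hAmax ε hε) hSmax hε.1 (hnet ε hε) hρ)⟩, ?_⟩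
  set M := LoadBalancing.expect (LoadBalancing.serviceLaw service)
    fun S => (∑ n, (S n : ℝ)) ^ 2
  let v : ℝ → ℝ := fun ε =>
    LoadBalancing.natVariance (arrival ε) + (μtot - ε) ^ 2 - 2 * μtot * (μtot - ε) + M
  have hv : ∀ ε ∈ Set.Ioo 0 μtot, LoadBalancing.expect
      (LoadBalancing.noiseLaw (arrival ε) service) (fun p => LoadBalancing.netInput p ^ 2)
        = v ε := fun ε hε => by
    rw [LoadBalancing.expect_netInput_sq (hAmax ε hε) hSmax, hmean ε hε, ← hμ]
  have hvlim : Filter.Tendsto v (nhdsWithin 0 (Set.Ioi 0))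
      (nhds (σsq + (μtot - 0) ^ 2 - 2 * μtot * (μtot - 0) + M)) := by
    have hsub : Filter.Tendsto (fun ε => μtot - ε) (nhdsWithin 0 (Set.Ioi 0))
        (nhds (μtot - 0)) :=
      (Filter.tendsto_id.mono_left nhdsWithin_le_nhds).const_sub μtot
    exact ((hvar.add (hsub.pow 2)).sub (hsub.const_mul _)).add_const M
  -- The limit is half of `σsq + (M - μtot ^ 2)`: the limiting arrival variance plus the variance of
  -- the total service.
  refine ⟨(σsq + (μtot - 0) ^ 2 - 2 * μtot * (μtot - 0) + M) / 2, fun ν ρ hν hρ => ⟨?_, ?_⟩⟩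
  · set D := LoadBalancing.slotBound N Amax Smax
    -- The constant `c` is free of `ε` because `T₂`, `K₂`, `η` and `Amax` are.
    refine LoadBalancing.tendsto_of_heavy_traffic_bounds (b := Amax + N * Smax)
      (c := 2 * (N ^ 2 * (LoadBalancing.momentBound η (2 * K₂ + T₂ * D ^ 2) (T₂ * D) / η))
        + (Amax + N * Smax) / 2) (lt_min hμ_pos hε₀) hvlim fun ε hε => ?_
    have hε' : ε ∈ Set.Ioo 0 μtot := ⟨hε.1, hε.2.trans_le (min_le_left _ _)⟩
    let sys : LoadBalancing.System N := ⟨arrival ε, service, policy⟩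
    have hp := LoadBalancing.System.perp_second_moment (sys := sys) hN (hAmax ε hε') hSmax
      (h𝒵 ε hε') hT₂ hη (hperp ε hε' (hε.2.trans_le (min_le_right _ _))) (hν ε hε')
    have h2 := LoadBalancing.System.total_second_moment (sys := sys) (hAmax ε hε') hSmax
      (h𝒵 ε hε') (hthroughput ε hε') (hν ε hε')
    exact LoadBalancing.System.total_bounds (sys := sys) (hAmax ε hε') hSmax hε.1 (hnet ε hε')
      (hv ε hε') (hν ε hε').2 h2 hp.1 hp.2
  · exact LoadBalancing.tendsto_of_heavy_traffic_bounds hμ_pos hvlim fun ε hε =>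
      LoadBalancing.pooled_bounds (hAmax ε hε) hSmax hε.1 (hnet ε hε) (hρ ε hε) (hv ε hε)
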